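/- Digraphs are finite and have no loops and no parallel arcs, but may contain digons (pairs of opposite arcs $(a,b),(b,a)$). The dichromatic number $\vec\chi(D)$ is the least $k$ such that $V(D)$ can be coloured with $k$ colours so that each colour class induces a subdigraph without directed cycles. A subdivision of a digraph $F$ is obtained by replacing each arc $(a,b)$ of $F$ by a directed path from $a$ to $b$ of length at least $1$, these paths being pairwise internally vertex-disjoint, with no vertex of $F$ as an internal vertex. Let $\mathrm{mader}_{\vec\chi}(F)$ be the smallest integer $k$ such that every digraph $D$ with $\vec\chi(D)\ge k$ contains a subdivision of $F$ as a subdigraph. Let $H_1$ and $H_2$ be the following two proper subdigraphs of the biorientation of the $4$-cycle $v_0v_1v_2v_3$, both with vertex set $\{v_0,v_1,v_2,v_3\}$: $$A(H_1)=\{(v_0,v_1),(v_1,v_0),(v_0,v_3),(v_3,v_0),(v_1,v_2),(v_2,v_3)\},$$ $$A(H_2)=\{(v_0,v_1),(v_1,v_0),(v_0,v_3),(v_3,v_0),(v_1,v_2),(v_3,v_2)\}.$$ **Theorem.** $\mathrm{mader}_{\vec\chi}(K)=4$ for each $K\in\{H_1,H_2\}$. That is, every digraph with dichromatic number at least $4$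 contains a subdivision of $H_1$ and a subdivision of $H_2$, and in neither case can $4$ be replaced by a smaller integer. -/

import Mathlib

/-! Digraphs have a finite vertex set, no loops and no parallel arcs; pairs of opposite arcs (digons)
are allowed. They are modelled by Mathlib's `Digraph V` together with `[Finite V]` and
`Digraph.Loopless`. -/

universe u v

namespace Digraph

/-- No vertex has an arc to itself. -/
def Loopless {V : Type u} (D : Digraph V) : Prop :=
  ∀ x : V, ¬ D.Adj x x

/-- `l` is the vertex sequence of a dipath: pairwise distinct vertices, each joined to the next one
by an arc of `D`. -/
def IsDipath {V : Type u} (D : Digraph V) (l : List V) : Prop :=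
  l.IsChain D.Adj ∧ l.Nodup

/-- `x :: l` is the vertex sequence of a dicycle: a dipath whose last vertex has an arc to its
first vertex `x`. -/
def IsDicycle {V : Type u} (D : Digraph V) (x : V) (l : List V) : Prop :=
  D.IsDipath (x :: l) ∧ D.Adj ((x :: l).getLast (List.cons_ne_nil x l)) x

/-- The subdigraph of `D` induced by the vertex set `S` is acyclic: `S` contains no dicycle. -/
def AcyclicOn {V : Type u} (D : Digraph V) (S : Set V) : Prop :=
  ∀ (x : V) (l : List V), D.IsDicycle x l → ¬ ∀ y ∈ x :: l, y ∈ S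

/-- `c` is an acyclic `k`-colouring: every colour class induces an acyclic subdigraph. -/
def IsAcyclicColoring {V : Type u} (D : Digraph V) {k : ℕ} (c : V → Fin k) : Prop :=
  ∀ i : Fin k, D.AcyclicOn (c ⁻¹' {i})

/-- The dichromatic number: the least `k` such that `D` has an acyclic `k`-colouring. Such a `k`
exists for every finite loopless digraph (give all vertices different colours). -/
noncomputable def dichromaticNumber {V : Type u} (D : Digraph V) : ℕ :=
  sInf {k : ℕ | ∃ c : V → Fin k, D.IsAcyclicColoring c}

/-- `D` contains a subdivision of `F`: there are distinct branch vertices `φ a` in `D`, and for every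
arc `(a, b)` of `F` a dipath of `D` from `φ a` to `φ b` with list `P a b` of internal vertices, such
that no internal vertex is a branch vertex and the dipaths of different arcs have no common internal
vertex. (`P a b` is irrelevant when `(a, b)` is not an arc of `F`.) -/
def ContainsSubdivision {V : Type u} {W : Type v} (D : Digraph V) (F : Digraph W) : Prop :=
  ∃ (φ : W → V) (P : W → W → List V),
    Function.Injective φ ∧
    (∀ a b, F.Adj a b → D.IsDipath (φ a :: (P a b ++ [φ b]))) ∧
    (∀ a b, F.Adj a b → ∀ z ∈ P a b, z ∉ Set.range φ) ∧
    (∀ a b a' b', F.Adj a b → F.Adj a' b' → (a, b) ≠ (a', b') →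
      List.Disjoint (P a b) (P a' b'))

/-- The Mader number of `F` with respect to the dichromatic number equals `m`: `m` is the smallest
`k` such that every digraph of dichromatic number at least `k` contains a subdivision of `F`. -/
def HasMaderNumber {W : Type v} (F : Digraph W) (m : ℕ) : Prop :=
  IsLeast {k : ℕ | ∀ (V : Type u) [Finite V] (D : Digraph V), D.Loopless →
    k ≤ D.dichromaticNumber → D.ContainsSubdivision F} m

end Digraph

/-- The biorientation of the 4-cycle `0 1 2 3` without the arcs `(2, 1)` and `(3, 2)`: the digons
`0 ⇄ 1` and `0 ⇄ 3`, and the directed path `1 → 2 → 3`. -/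
def digraphH1 : Digraph (Fin 4) where
  Adj a b := (a, b) ∈
    ({(0, 1), (1, 0), (0, 3), (3, 0), (1, 2), (2, 3)} : Set (Fin 4 × Fin 4))

/-- The biorientation of the 4-cycle `0 1 2 3` without the arcs `(2, 1)` and `(2, 3)`: the digons
`0 ⇄ 1` and `0 ⇄ 3`, and the two arcs `1 → 2` and `3 → 2`. -/
def digraphH2 : Digraph (Fin 4) where
  Adj a b := (a, b) ∈
    ({(0, 1), (1, 0), (0, 3), (3, 0), (1, 2), (3, 2)} : Set (Fin 4 × Fin 4))

/-!
The lower bound is witnessed by the biorientation of a triangle, which has dichromatic number 3 but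
too few vertices. For the upper bound it suffices to treat a digraph `D` that is critical: `D` has
no acyclic 3-colouring, but all its proper induced subdigraphs have one. Such a `D` is strongly
connected and all its out-degrees are at least two, and this forces the existence of a vertex `y`
with `D - y` strongly connected (`exists_strongOn_compl`: an ear attached to a maximal strongly
connected proper vertex subset consists of a single vertex). Since `y` cannot be added to any colour
class of a 3-colouring of `D - y`, there is a *flower* with centre `y`: three dicycles through `y`
any two of which meet only in `y` (`IsFourCritical.exists_isFlower`). The paths `X i` that remain
after deleting `y` are its petals.

Two petals, together with a walk in `D - y` from one to the other with an inner vertex outside both,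
give a subdivision of `digraphH1`. As `D - y` is strongly connected, such a walk exists for some two
of three petals (`IsFlower.containsSubdivision_digraphH1`).

Two petals, together with a vertex reached from each of them by a walk avoiding `y` and the other
petal, give a subdivision of `digraphH2`. Suppose that there is none, and take a flower with the
maximum number of petals. Then the regions reached from the single petals (by walks avoiding `y` and
the other petals) partition `D - y`. An arc from one region to another ends on a petal, and all
arcs entering a given petal in this way come from the same region. The last vertex of a petal at
which such an arc enters is its gate. A walk that enters the region of a petal before the gate
cannot go on to `y` without passing through the gate or through the preceding region
(`IsFlower.not_reach_center`). By the maximality of the flower, each region together with `y` has a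
3-colouring that gives the gate and `y` different colours (`IsFlower.exists_coloring_region`). After
permuting colours, `y` has colour `0`, one gate has colour `1` and the other gates have colour `2`.
Then no monochromatic closed walk passes through `y`, as its last portion would enter a region and
reach `y` while avoiding the gate (`IsFlower.not_transGen_center`). A monochromatic closed walk
that avoids `y` and leaves a region visits all the gates (`IsFlower.gate_mem_of_closedWalk`), which
do not all have the same colour. So `D` is 3-colourable, a contradiction.
-/

namespace Digraph

open Relation

variable {V : Type u}

/-! ### Walks, paths and dicycles -/

/-- The arcs of `D` with both ends in `S`. -/
def RelOn (D : Digraph V) (S : Set V) (a b : V) : Prop :=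
  a ∈ S ∧ b ∈ S ∧ D.Adj a b

theorem RelOn.mono {D : Digraph V} {S T : Set V} (h : S ⊆ T) {a b : V} (hab : D.RelOn S a b) :
    D.RelOn T a b :=
  ⟨h hab.1, h hab.2.1, hab.2.2⟩

theorem reach_mono {D : Digraph V} {S T : Set V} (h : S ⊆ T) {a b : V}
    (hab : ReflTransGen (D.RelOn S) a b) : ReflTransGen (D.RelOn T) a b :=
  ReflTransGen.mono (fun _ _ h' => RelOn.mono h h') _ _ hab

/-- A walk from `S` to `M` contains a path from `S` to `M` with no internal vertex in `S ∪ M`. -/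
theorem exists_path_between {r : V → V → Prop} {S M : Set V} {s z : V}
    (h : ReflTransGen r s z) (hs : s ∈ S) (hz : z ∈ M) (hSM : Disjoint S M) :
    ∃ a ∈ S, ∃ m ∈ M, ∃ q : List V, (a :: (q ++ [m])).IsChain r ∧ (a :: (q ++ [m])).Nodup ∧
      ∀ x ∈ q, x ∉ S ∧ x ∉ M := by
  have key : ∀ x, ReflTransGen r x z → x ∉ M → ∃ a, ∃ m ∈ M, ∃ q : List V,
      (a = x ∨ a ∈ S) ∧ a ∉ M ∧ (a :: (q ++ [m])).IsChain r ∧ (a :: (q ++ [m])).Nodup ∧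
      ∀ x ∈ q, x ∉ S ∧ x ∉ M := by
    intro x hx
    induction hx using ReflTransGen.head_induction_on with
    | refl => exact fun h => absurd hz h
    | @head x x' hxx' _ ih =>
      intro hxM
      by_cases hx'M : x' ∈ M
      · refine ⟨x, x', hx'M, [], Or.inl rfl, hxM, by simpa using hxx', ?_, by simp⟩
        have : x ≠ x' := fun e => hxM (e ▸ hx'M)
        simpa using this
      obtain ⟨a, m, hm, q, ha, haM, hc, hn, hq⟩ := ih hx'M
      by_cases haS : a ∈ S
      · exact ⟨a, m, hm, q, Or.inr haS, haM, hc, hn, hq⟩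
      obtain rfl : a = x' := ha.resolve_right haS
      by_cases hxq : x ∈ a :: q
      · obtain ⟨q₁, q₂, e⟩ := List.append_of_mem hxq
        have e' : a :: (q ++ [m]) = q₁ ++ x :: (q₂ ++ [m]) := by
          rw [← List.cons_append, e]; simp
        rw [e'] at hc hn
        refine ⟨x, m, hm, q₂, Or.inl rfl, hxM, (List.isChain_append.1 hc).2.1,
          (List.nodup_append.1 hn).2.1, fun y hy => ?_⟩
        have hy' : y ∈ a :: q := by rw [e]; simp [hy]
        rcases List.mem_cons.1 hy' with rfl | hy'
        · exact ⟨haS, haM⟩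
        · exact hq y hy'
      · refine ⟨x, m, hm, a :: q, Or.inl rfl, hxM, ?_, ?_, ?_⟩
        · simpa using ⟨hxx', by simpa using hc⟩
        · have hxm : x ≠ m := fun e => hxM (e ▸ hm)
          rw [List.cons_append, List.nodup_cons]
          refine ⟨?_, hn⟩
          simp only [List.mem_cons, List.mem_append] at hxq ⊢
          simp; tauto
        · intro y hy
          rcases List.mem_cons.1 hy with rfl | hy
          · exact ⟨haS, haM⟩
          · exact hq y hy
  obtain ⟨a, m, hm, q, ha, -, h1, h2, h3⟩ := key s h (fun h => hSM.notMem_of_mem_left hs h)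
  refine ⟨a, ?_, m, hm, q, h1, h2, h3⟩
  rcases ha with rfl | ha
  · exact hs
  · exact ha

/-- A walk leaving `Q` stays in `Q` up to the first arc leaving `Q`. -/
theorem exists_first_exit {r : V → V → Prop} {Q : Set V} {x z : V} (h : ReflTransGen r x z)
    (hx : x ∈ Q) (hz : z ∉ Q) :
    ∃ t b, ReflTransGen (fun a b => a ∈ Q ∧ b ∈ Q ∧ r a b) x t ∧ t ∈ Q ∧ b ∉ Q ∧ r t b ∧
      ReflTransGen r b z := by
  induction h using ReflTransGen.head_induction_on with
  | refl => exact absurd hx hz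
  | @head x x' hxx' h' ih =>
    by_cases hx' : x' ∈ Q
    · obtain ⟨t, b, h1, h2⟩ := ih hx'
      exact ⟨t, b, ReflTransGen.head ⟨hx, hx', hxx'⟩ h1, h2⟩
    · exact ⟨x, x', .refl, hx, hx', hxx', h'⟩

theorem isChain_adj_of_relOn {D : Digraph V} {S : Set V} {l : List V}
    (h : l.IsChain (D.RelOn S)) : l.IsChain D.Adj :=
  h.imp fun _ _ h => h.2.2

theorem mem_of_isChain_relOn {D : Digraph V} {S : Set V} :
    ∀ {a m : V} {q : List V}, (a :: (q ++ [m])).IsChain (D.RelOn S) → ∀ x ∈ a :: (q ++ [m]), x ∈ S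
  | a, m, [], h, x, hx => by
    simp [RelOn] at h hx
    rcases hx with rfl | rfl
    exacts [h.1, h.2.1]
  | a, m, b :: q, h, x, hx => by
    rw [List.cons_append, List.isChain_cons_cons] at h
    rw [List.cons_append] at hx
    rcases List.mem_cons.1 hx with rfl | hx
    · exact h.1.1
    · exact mem_of_isChain_relOn h.2 x hx

/-- The vertices of a directed path reach each other inside the path, in the order of the path. -/
theorem reach_of_isChain {D : Digraph V} {p q : List V} {a b : V}
    (h : (p ++ b :: q).IsChain D.Adj) (ha : a ∈ p) :
    ReflTransGen (D.RelOn {x | x ∈ p ∨ x = b}) a b := by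
  induction p generalizing a with
  | nil => simp at ha
  | cons c p ih =>
    have key : ∀ d, d ∈ p → ReflTransGen (D.RelOn {x | x ∈ c :: p ∨ x = b}) d b := fun d hd =>
      reach_mono (by intro x; simp; tauto) (ih (List.isChain_of_isChain_cons h) hd)
    rcases List.mem_cons.1 ha with rfl | ha
    · cases p with
      | nil =>
        refine ReflTransGen.single ⟨by simp, by simp, ?_⟩
        simpa using (List.isChain_cons_cons.1 h).1
      | cons d p =>
        exact ReflTransGen.head ⟨by simp, by simp, (List.isChain_cons_cons.1 h).1⟩
          (key d (by simp))
    · exact key a ha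

theorem IsDicycle.ne_nil {D : Digraph V} (hD : D.Loopless) {y : V} {l : List V}
    (h : D.IsDicycle y l) : l ≠ [] := by
  rintro rfl
  exact hD y (by simpa using h.2)

theorem IsDicycle.notMem {D : Digraph V} {y : V} {l : List V} (h : D.IsDicycle y l) : y ∉ l :=
  (List.nodup_cons.1 h.1.2).1

theorem IsDicycle.nodup {D : Digraph V} {y : V} {l : List V} (h : D.IsDicycle y l) : l.Nodup :=
  (List.nodup_cons.1 h.1.2).2

theorem IsDicycle.isChain {D : Digraph V} {y : V} {l : List V} (h : D.IsDicycle y l) :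
    (y :: (l ++ [y])).IsChain D.Adj := by
  rw [← List.cons_append, List.isChain_append]
  refine ⟨h.1.1, by simp, ?_⟩
  intro a ha b hb
  have : b = y := by simpa using hb.symm
  subst this
  rw [List.getLast?_eq_some_getLast (List.cons_ne_nil _ _)] at ha
  have : a = _ := (by simpa using ha.symm)
  rw [this]
  exact h.2

theorem isDicycle_of_isChain {D : Digraph V} {y : V} {l : List V}
    (h : (y :: (l ++ [y])).IsChain D.Adj) (hn : (y :: l).Nodup) : D.IsDicycle y l := by
  rw [← List.cons_append, List.isChain_append] at h
  exact ⟨⟨h.1, hn⟩, h.2.2 _ (List.getLast?_eq_some_getLast _) y (by simp)⟩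

/-- A closed walk through `y` contains a dicycle through `y` with the same first arc. -/
theorem exists_dicycle_of_reach {D : Digraph V} {S : Set V} {y x : V}
    (hyx : D.Adj y x) (hne : x ≠ y) (h : ReflTransGen (D.RelOn S) x y) :
    ∃ l : List V, D.IsDicycle y (x :: l) ∧ ∀ v ∈ x :: l, v ∈ S := by
  obtain ⟨a, rfl, m, rfl, q, hc, hn, -⟩ := exists_path_between (S := {x}) (M := {y}) h rfl rfl
    (by simpa using hne)
  refine ⟨q, isDicycle_of_isChain ?_ ?_, fun v hv => ?_⟩
  · rw [List.cons_append, List.isChain_cons_cons]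
    exact ⟨hyx, isChain_adj_of_relOn hc⟩
  · rw [← List.cons_append, List.nodup_append_comm] at hn
    simpa using hn
  · refine mem_of_isChain_relOn hc v ?_
    rw [← List.cons_append]
    exact List.mem_append_left _ hv

theorem exists_dicycle_of_transGen {D : Digraph V} (hD : D.Loopless) {S : Set V} {y : V}
    (h : TransGen (D.RelOn S) y y) : ∃ l : List V, D.IsDicycle y l ∧ ∀ v ∈ l, v ∈ S := by
  obtain ⟨x, hyx, hxy⟩ := TransGen.head'_iff.1 h
  obtain ⟨l, hl⟩ := exists_dicycle_of_reach hyx.2.2 (fun e => hD y (e ▸ hyx.2.2)) hxy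
  exact ⟨_, hl⟩

theorem IsDicycle.reach_center {D : Digraph V} {y : V} {l : List V} (h : D.IsDicycle y l) {a : V}
    (ha : a ∈ l) : ReflTransGen (D.RelOn {x | x ∈ l ∨ x = y}) a y :=
  reach_of_isChain (q := []) (List.isChain_of_isChain_cons h.isChain) ha

/-- Two vertices of a dicycle are joined by a path in at least one direction that avoids the
vertex `y`. -/
theorem IsDicycle.reach_or_reach {D : Digraph V} {y : V} {l : List V} (h : D.IsDicycle y l)
    {a b : V} (ha : a ∈ l) (hb : b ∈ l) :
    ReflTransGen (D.RelOn {x | x ∈ l}) a b ∨ ReflTransGen (D.RelOn {x | x ∈ l}) b a := by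
  have hc : l.IsChain D.Adj := List.isChain_of_isChain_cons h.1.1
  obtain ⟨p, q, rfl⟩ := List.append_of_mem hb
  rcases List.mem_append.1 ha with ha | ha
  · left
    exact reach_mono (by intro x; simp; tauto) (reach_of_isChain hc ha)
  rcases List.mem_cons.1 ha with rfl | ha
  · exact Or.inl .refl
  · right
    obtain ⟨q₁, q₂, rfl⟩ := List.append_of_mem ha
    have hc' : ((b :: q₁) ++ a :: q₂).IsChain D.Adj := (List.isChain_append.1 hc).2.1
    exact reach_mono (by intro x; simp; tauto) (reach_of_isChain hc' (a := b) (by simp))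

/-! ### Subdivisions from two dicycles with one common vertex -/

/-- The internal vertices of the paths of a subdivision of `digraphH1` or `digraphH2` whose branch
vertex `0` is the common vertex of two dicycles; `q₂` serves for both possible directions of the
path between the vertices `2` and `3`. -/
def twoCyclePaths (p₁ s₁ p₂ s₂ q₁ q₂ : List V) (i j : Fin 4) : List V :=
  ![![[], p₁, [], p₂], ![s₁, [], q₁, []], ![[], [], [], q₂], ![s₂, [], q₂, []]] i j

/-- A subdivision of a subdigraph `K` of the biorientation of the 4-cycle that has no arc from `2`
to `1` and at most one arc between `2` and `3`, from its branch vertices `y, a, m, b` and its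
subdivided arcs. -/
theorem containsSubdivision_of_paths {D : Digraph V} {K : Digraph (Fin 4)}
    (hK : ∀ i j, K.Adj i j → (i = 0 ∧ j = 1) ∨ (i = 1 ∧ j = 0) ∨ (i = 0 ∧ j = 3) ∨
      (i = 3 ∧ j = 0) ∨ (i = 1 ∧ j = 2) ∨ (i = 2 ∧ j = 3) ∨ (i = 3 ∧ j = 2))
    (hK' : K.Adj 2 3 → ¬ K.Adj 3 2) {y a b m : V} {p₁ s₁ p₂ s₂ q₁ q₂ : List V}
    (hn : ((y :: (p₁ ++ a :: s₁)) ++ ((p₂ ++ b :: s₂) ++ (q₁ ++ m :: q₂))).Nodup)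
    (h01 : (y :: (p₁ ++ [a])).IsChain D.Adj) (h10 : (a :: (s₁ ++ [y])).IsChain D.Adj)
    (h03 : (y :: (p₂ ++ [b])).IsChain D.Adj) (h30 : (b :: (s₂ ++ [y])).IsChain D.Adj)
    (h12 : (a :: (q₁ ++ [m])).IsChain D.Adj)
    (h23 : K.Adj 2 3 → (m :: (q₂ ++ [b])).IsChain D.Adj)
    (h32 : K.Adj 3 2 → (b :: (q₂ ++ [m])).IsChain D.Adj) : D.ContainsSubdivision K := by
  have hp : List.Perm ((y :: (p₁ ++ a :: s₁)) ++ ((p₂ ++ b :: s₂) ++ (q₁ ++ m :: q₂)))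
      (y :: a :: b :: m :: (p₁ ++ (s₁ ++ (p₂ ++ (s₂ ++ (q₁ ++ q₂)))))) := by
    classical
    rw [List.perm_iff_count]
    intro x
    simp only [List.count_cons, List.count_append]
    omega
  rw [hp.nodup_iff] at hn
  simp only [List.nodup_cons, List.nodup_append', List.mem_append, List.mem_cons, not_or,
    List.disjoint_append_right] at hn
  obtain ⟨⟨ya, yb, ym, y1, y2, y3, y4, y5, y6⟩, ⟨ab, am, a1, a2, a3, a4, a5, a6⟩,
    ⟨bm, b1, b2, b3, b4, b5, b6⟩, ⟨m1, m2, m3, m4, m5, m6⟩, n1,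
    ⟨n2, ⟨n3, ⟨n4, ⟨n5, n6, d56⟩, d45, d46⟩, d34, d35, d36⟩, d23, d24, d25, d26⟩,
      d12, d13, d14, d15, d16⟩ := hn
  refine ⟨![y, a, m, b], twoCyclePaths p₁ s₁ p₂ s₂ q₁ q₂, ?_, ?_, ?_, ?_⟩
  · intro i j
    fin_cases i <;> fin_cases j <;>
      simp [ya, yb, ym, ab, am, bm, Ne.symm ya, Ne.symm yb, Ne.symm ym, Ne.symm ab, Ne.symm am,
        Ne.symm bm]
  · intro i j hij
    rcases hK _ _ hij with ⟨rfl, rfl⟩ | ⟨rfl, rfl⟩ | ⟨rfl, rfl⟩ | ⟨rfl, rfl⟩ | ⟨rfl, rfl⟩ |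
      ⟨rfl, rfl⟩ | ⟨rfl, rfl⟩
    · exact ⟨h01, by simp [twoCyclePaths, List.nodup_append', *]⟩
    · exact ⟨h10, by simp [twoCyclePaths, List.nodup_append', Ne.symm ya, *]⟩
    · exact ⟨h03, by simp [twoCyclePaths, List.nodup_append', *]⟩
    · exact ⟨h30, by simp [twoCyclePaths, List.nodup_append', Ne.symm yb, *]⟩
    · exact ⟨h12, by simp [twoCyclePaths, List.nodup_append', *]⟩
    · exact ⟨h23 hij, by simp [twoCyclePaths, List.nodup_append', Ne.symm bm, *]⟩
    · exact ⟨h32 hij, by simp [twoCyclePaths, List.nodup_append', *]⟩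
  · have hr : ∀ z, z ∈ Set.range ![y, a, m, b] → z = y ∨ z = a ∨ z = b ∨ z = m := by
      rintro z ⟨i, rfl⟩
      fin_cases i <;> simp
    have key : ∀ l : List V, y ∉ l → a ∉ l → b ∉ l → m ∉ l → ∀ z ∈ l,
        z ∉ Set.range ![y, a, m, b] := by
      intro l hy ha hb hm z hz h
      rcases hr z h with rfl | rfl | rfl | rfl <;> contradiction
    intro i j hij
    rcases hK _ _ hij with ⟨rfl, rfl⟩ | ⟨rfl, rfl⟩ | ⟨rfl, rfl⟩ | ⟨rfl, rfl⟩ | ⟨rfl, rfl⟩ |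
      ⟨rfl, rfl⟩ | ⟨rfl, rfl⟩ <;>
      apply key <;> assumption
  · intro i j i' j' hij hij' hne
    rcases hK _ _ hij with ⟨rfl, rfl⟩ | ⟨rfl, rfl⟩ | ⟨rfl, rfl⟩ | ⟨rfl, rfl⟩ | ⟨rfl, rfl⟩ |
      ⟨rfl, rfl⟩ | ⟨rfl, rfl⟩ <;>
    rcases hK _ _ hij' with ⟨rfl, rfl⟩ | ⟨rfl, rfl⟩ | ⟨rfl, rfl⟩ | ⟨rfl, rfl⟩ | ⟨rfl, rfl⟩ |
      ⟨rfl, rfl⟩ | ⟨rfl, rfl⟩ <;>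
      first
        | exact absurd rfl hne
        | exact absurd hij' (hK' hij)
        | exact absurd hij (hK' hij')
        | assumption
        | (apply List.Disjoint.symm; assumption)

/-- Two dicycles meeting exactly in `y`, together with a path of length at least two from one to
the other avoiding `y`, form a subdivision of `digraphH1`. The path is given by a vertex `z` reached
from the first dicycle and dominating a vertex of the second one. -/
theorem IsDicycle.containsSubdivision_digraphH1 {D : Digraph V} {y a z b : V} {l₁ l₂ : List V}
    (h₁ : D.IsDicycle y l₁) (h₂ : D.IsDicycle y l₂) (hd : l₁.Disjoint l₂) (ha : a ∈ l₁)
    (haz : ReflTransGen (D.RelOn {x | x ≠ y ∧ x ∉ l₂}) a z) (hz : z ∉ l₁) (hzb : D.Adj z b)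
    (hb : b ∈ l₂) : D.ContainsSubdivision digraphH1 := by
  obtain ⟨a, ha, m, rfl, q, hc, hn, hq⟩ := exists_path_between (S := {x | x ∈ l₁}) (M := {z}) haz ha
    rfl (by simpa using hz)
  have hU := mem_of_isChain_relOn hc
  obtain ⟨p₁, s₁, rfl⟩ := List.append_of_mem ha
  obtain ⟨p₂, s₂, rfl⟩ := List.append_of_mem hb
  have c₁ := h₁.isChain
  have c₂ := h₂.isChain
  have n₁ := h₁.1.2
  have n₂ := h₂.1.2
  rw [List.append_assoc, List.cons_append, ← List.cons_append, List.isChain_split] at c₁ c₂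
  refine containsSubdivision_of_paths (by simp [digraphH1]; omega) (by simp [digraphH1])
    (y := y) (a := a) (b := b) (m := m)
    (p₁ := p₁) (s₁ := s₁) (p₂ := p₂) (s₂ := s₂) (q₁ := q) (q₂ := []) ?_ c₁.1 c₁.2 c₂.1 c₂.2
    (isChain_adj_of_relOn hc) (fun _ => by simpa using hzb) (by simp [digraphH1])
  refine List.nodup_append'.2
    ⟨n₁, List.nodup_append'.2 ⟨h₂.nodup, (List.nodup_cons.1 hn).2, ?_⟩, ?_⟩
  · exact fun x hx hx' => (hU x (List.mem_cons_of_mem _ hx')).2 hx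
  · intro x hx hx'
    have hx₂ : x ∈ p₂ ++ b :: s₂ → x ∉ y :: (p₁ ++ a :: s₁) := by
      intro h h'
      rcases List.mem_cons.1 h' with rfl | h'
      · exact h₂.notMem h
      · exact hd h' h
    rcases List.mem_append.1 hx' with hx' | hx'
    · exact hx₂ hx' hx
    rcases List.mem_cons.1 hx with rfl | hx
    · exact (hU x (List.mem_cons_of_mem _ hx')).1 rfl
    rcases List.mem_append.1 hx' with hx' | hx'
    · exact (hq x hx').1 hx
    · exact hz (List.mem_singleton.1 hx' ▸ hx)

/-- Two dicycles meeting exactly in `y`, together with a vertex reached from each of them by a walk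
avoiding `y` and the other one, contain a subdivision of `digraphH2`. -/
theorem IsDicycle.containsSubdivision_digraphH2 {D : Digraph V} {y a z b : V} {l₁ l₂ : List V}
    (h₁ : D.IsDicycle y l₁) (h₂ : D.IsDicycle y l₂) (hd : l₁.Disjoint l₂) (ha : a ∈ l₁)
    (haz : ReflTransGen (D.RelOn {x | x ≠ y ∧ x ∉ l₂}) a z) (hb : b ∈ l₂)
    (hbz : ReflTransGen (D.RelOn {x | x ≠ y ∧ x ∉ l₁}) b z) : D.ContainsSubdivision digraphH2 := by
  have hz₁ : z ∉ l₁ := by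
    rcases ReflTransGen.cases_tail hbz with rfl | ⟨_, -, h⟩
    · exact fun h => hd h hb
    · exact h.2.1.2
  have hz₂ : z ∉ l₂ := by
    rcases ReflTransGen.cases_tail haz with rfl | ⟨_, -, h⟩
    · exact fun h => hd ha h
    · exact h.2.1.2
  obtain ⟨a, ha, m, rfl, q, hc, hn, hq⟩ := exists_path_between (S := {x | x ∈ l₁}) (M := {z}) haz ha
    rfl (by simpa using hz₁)
  have hU := mem_of_isChain_relOn hc
  have hq₁ : ∀ x ∈ q ++ [m], x ∉ l₁ := by
    intro x hx
    rcases List.mem_append.1 hx with hx | hx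
    · exact (hq x hx).1
    · exact List.mem_singleton.1 hx ▸ hz₁
  -- The second path is stopped where it first meets the first one.
  obtain ⟨b, hb, z, hz, q₂, hc', hn', hq'⟩ := exists_path_between (S := {x | x ∈ l₂})
    (M := {x | x ∈ q ++ [m]}) hbz hb (by simp) (by
      rw [Set.disjoint_left]
      intro x hx hx'
      exact (hU x (List.mem_cons_of_mem _ hx')).2 hx)
  have hU' := mem_of_isChain_relOn hc'
  obtain ⟨q₁, t, e⟩ := List.append_of_mem hz
  simp only [e] at hc hn hU hq' hq₁
  rw [← List.cons_append, List.isChain_split] at hc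
  obtain ⟨p₁, s₁, rfl⟩ := List.append_of_mem ha
  obtain ⟨p₂, s₂, rfl⟩ := List.append_of_mem hb
  have c₁ := h₁.isChain
  have c₂ := h₂.isChain
  have n₁ := h₁.1.2
  have n₂ := h₂.1.2
  rw [List.append_assoc, List.cons_append, ← List.cons_append, List.isChain_split] at c₁ c₂
  refine containsSubdivision_of_paths (by simp [digraphH2]; omega) (by simp [digraphH2])
    (y := y) (a := a) (b := b) (m := z)
    (p₁ := p₁) (s₁ := s₁) (p₂ := p₂) (s₂ := s₂) (q₁ := q₁) (q₂ := q₂) ?_ c₁.1 c₁.2 c₂.1 c₂.2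
    (isChain_adj_of_relOn hc.1) (by simp [digraphH2]) (fun _ => isChain_adj_of_relOn hc')
  have hn₁ : (q₁ ++ [z]).Nodup := (List.nodup_cons.1 hn).2.sublist (by simp)
  have hn₂ : (q₂ ++ [z]).Nodup := (List.nodup_cons.1 hn').2
  have hq₁₂ : ∀ x ∈ q₁ ++ z :: q₂, x ∈ q₁ ++ z :: t ∨ x ∈ q₂ := by
    intro x
    simp only [List.mem_append, List.mem_cons]
    tauto
  refine List.nodup_append'.2 ⟨n₁, List.nodup_append'.2 ⟨h₂.nodup, ?_, ?_⟩, ?_⟩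
  · have hp : List.Perm (q₁ ++ z :: q₂) (q₁ ++ (q₂ ++ [z])) :=
      List.Perm.append_left _ (List.perm_append_singleton _ _).symm
    rw [hp.nodup_iff]
    refine List.nodup_append'.2 ⟨(List.nodup_append.1 hn₁).1, hn₂, ?_⟩
    intro x hx hx'
    rcases List.mem_append.1 hx' with hx' | hx'
    · exact (hq' x hx').2 (List.mem_append_left _ hx)
    · obtain rfl := List.mem_singleton.1 hx'
      exact (List.nodup_append'.1 hn₁).2.2 hx (by simp)
  · intro x hx hx'
    rcases hq₁₂ x hx' with hx' | hx'
    · exact (hU x (List.mem_cons_of_mem _ hx')).2 hx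
    · exact (hq' x hx').1 hx
  · intro x hx hx'
    rcases List.mem_cons.1 hx with rfl | hx
    · rcases List.mem_append.1 hx' with hx' | hx'
      · exact h₂.notMem hx'
      rcases hq₁₂ x hx' with hx' | hx'
      · exact (hU x (List.mem_cons_of_mem _ hx')).1 rfl
      · exact (hU' x (by simp [hx'])).1 rfl
    · rcases List.mem_append.1 hx' with hx' | hx'
      · exact hd hx hx'
      rcases hq₁₂ x hx' with hx' | hx'
      · exact hq₁ x hx' hx
      · exact (hU' x (by simp [hx'])).2 hx

/-! ### Critical digraphs -/

/-- No closed walk of positive length stays inside `S`; equivalently, `S` induces an acyclic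
subdigraph. -/
def NoClosedWalk (D : Digraph V) (S : Set V) : Prop :=
  ∀ v, ¬ TransGen (D.RelOn S) v v

/-- The subdigraph induced by `S` has an acyclic 3-colouring. -/
def ThreeColorableOn (D : Digraph V) (S : Set V) : Prop :=
  ∃ c : V → Fin 3, ∀ i, D.NoClosedWalk (S ∩ c ⁻¹' {i})

/-- `D` is vertex-critical: it has no acyclic 3-colouring, but each of its proper induced
subdigraphs has one. -/
def IsFourCritical (D : Digraph V) : Prop :=
  ¬ D.ThreeColorableOn Set.univ ∧ ∀ S, S ≠ Set.univ → D.ThreeColorableOn S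

theorem transGen_mono {D : Digraph V} {S T : Set V} (h : S ⊆ T) {a b : V}
    (hab : TransGen (D.RelOn S) a b) : TransGen (D.RelOn T) a b :=
  TransGen.mono (fun _ _ h' => RelOn.mono h h') _ _ hab

theorem NoClosedWalk.mono {D : Digraph V} {S T : Set V} (h : S ⊆ T) (hT : D.NoClosedWalk T) :
    D.NoClosedWalk S :=
  fun v hv => hT v (transGen_mono h hv)

theorem reach_avoiding {D : Digraph V} {S : Set V} (y : V) {v w : V}
    (h : ReflTransGen (D.RelOn S) v w) :
    (ReflTransGen (D.RelOn S) v y ∧ ReflTransGen (D.RelOn S) y w) ∨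
      ReflTransGen (D.RelOn (S \ {y})) v w := by
  induction h with
  | refl => exact Or.inr .refl
  | @tail u w hvu huw ih =>
    rcases ih with ⟨h₁, h₂⟩ | h
    · exact Or.inl ⟨h₁, h₂.tail huw⟩
    by_cases hu : u = y
    · subst hu
      exact Or.inl ⟨hvu, .single huw⟩
    by_cases hw : w = y
    · subst hw
      exact Or.inl ⟨hvu.tail huw, .refl⟩
    exact Or.inr (h.tail ⟨⟨huw.1, hu⟩, ⟨huw.2.1, hw⟩, huw.2.2⟩)

/-- If `y` lies on no closed walk in `S`, then every closed walk in `S` avoids `y`. -/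
theorem transGen_avoiding {D : Digraph V} {S : Set V} {y v : V}
    (hy : ¬ TransGen (D.RelOn S) y y) (h : TransGen (D.RelOn S) v v) :
    TransGen (D.RelOn (S \ {y})) v v := by
  obtain ⟨w, hvw, hwv⟩ := TransGen.head'_iff.1 h
  have hvy : v ≠ y := by
    rintro rfl
    exact hy h
  rcases reach_avoiding y hwv with ⟨h₁, h₂⟩ | h'
  · exact absurd (TransGen.trans_right h₂ (TransGen.head' hvw h₁)) hy
  · refine TransGen.head' ⟨⟨hvw.1, hvy⟩, ⟨hvw.2.1, ?_⟩, hvw.2.2⟩ h'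
    rintro rfl
    exact hy (TransGen.tail' hwv hvw)

theorem noClosedWalk_of_notThrough {D : Digraph V} {S : Set V} {y : V}
    (hy : ¬ TransGen (D.RelOn S) y y) (h : D.NoClosedWalk (S \ {y})) : D.NoClosedWalk S :=
  fun v hv => h v (transGen_avoiding hy hv)

/-- A new vertex that lies on no closed walk in its colour class can be added to a colouring. -/
theorem noClosedWalk_update [DecidableEq V] {D : Digraph V} {S : Set V} {y : V} {c : V → Fin 3}
    (hc : ∀ i, D.NoClosedWalk (S ∩ c ⁻¹' {i})) {j : Fin 3}
    (hj : ¬ TransGen (D.RelOn (insert y (S ∩ c ⁻¹' {j}))) y y) (i : Fin 3) :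
    D.NoClosedWalk (insert y S ∩ Function.update c y j ⁻¹' {i}) := by
  have hsub : (insert y S ∩ Function.update c y j ⁻¹' {i}) \ {y} ⊆ S ∩ c ⁻¹' {i} := by
    rintro x ⟨⟨hx, hxi⟩, hxy⟩
    have hxy' : x ≠ y := hxy
    refine ⟨hx.resolve_left hxy', ?_⟩
    simpa [Function.update_of_ne hxy'] using hxi
  refine noClosedWalk_of_notThrough (y := y) (fun h => ?_) ((hc i).mono hsub)
  obtain ⟨w, hw, -⟩ := TransGen.head'_iff.1 h
  have hij : j = i := by simpa using hw.1.2
  subst hij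
  refine hj (transGen_mono ?_ h)
  intro x hx
  by_cases hxy : x = y
  · exact Or.inl hxy
  · exact Or.inr (hsub ⟨hx, hxy⟩)

/-- If no arc leaves `R`, then every closed walk stays in `R` or in its complement. -/
theorem noClosedWalk_of_outClosed {D : Digraph V} {S R : Set V}
    (hR : ∀ a ∈ R, ∀ b, D.Adj a b → b ∈ R)
    (h₁ : D.NoClosedWalk (S ∩ R)) (h₂ : D.NoClosedWalk (S \ R)) : D.NoClosedWalk S := by
  have key₁ : ∀ v w, TransGen (D.RelOn S) v w → v ∈ R → w ∈ R ∧ TransGen (D.RelOn (S ∩ R)) v w := by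
    intro v w h hv
    induction h with
    | single h =>
      have := hR _ hv _ h.2.2
      exact ⟨this, .single ⟨⟨h.1, hv⟩, ⟨h.2.1, this⟩, h.2.2⟩⟩
    | tail _ h ih =>
      have := hR _ ih.1 _ h.2.2
      exact ⟨this, ih.2.tail ⟨⟨h.1, ih.1⟩, ⟨h.2.1, this⟩, h.2.2⟩⟩
  have key₂ : ∀ v w, TransGen (D.RelOn S) v w → w ∉ R → v ∉ R ∧ TransGen (D.RelOn (S \ R)) v w := by
    intro v w h hw
    induction h with
    | single h =>
      have := fun h' => hw (hR _ h' _ h.2.2)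
      exact ⟨this, .single ⟨⟨h.1, this⟩, ⟨h.2.1, hw⟩, h.2.2⟩⟩
    | tail _ h ih =>
      have := fun h' => hw (hR _ h' _ h.2.2)
      exact ⟨(ih this).1, (ih this).2.tail ⟨⟨h.1, this⟩, ⟨h.2.1, hw⟩, h.2.2⟩⟩
  intro v hv
  by_cases h : v ∈ R
  · exact h₁ v (key₁ v v hv h).2
  · exact h₂ v (key₂ v v hv h).2

/-- `S` induces a strongly connected subdigraph. -/
def StrongOn (D : Digraph V) (S : Set V) : Prop :=
  ∀ a ∈ S, ∀ b ∈ S, ReflTransGen (D.RelOn S) a b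

theorem IsFourCritical.strongOn {D : Digraph V} (hD : D.IsFourCritical) :
    D.StrongOn Set.univ := by
  classical
  intro a _ b _
  by_contra hab
  set R : Set V := {x | ReflTransGen (D.RelOn Set.univ) a x} with hR
  obtain ⟨c₁, hc₁⟩ := hD.2 R (fun e => hab (show b ∈ R from e ▸ Set.mem_univ b))
  obtain ⟨c₂, hc₂⟩ := hD.2 Rᶜ (fun e => by
    have : a ∈ Rᶜ := e ▸ Set.mem_univ a
    exact this .refl)
  refine hD.1 ⟨fun x => if x ∈ R then c₁ x else c₂ x, fun i => ?_⟩
  refine noClosedWalk_of_outClosed (R := R)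
    (fun x hx z hxz => ReflTransGen.tail hx ⟨trivial, trivial, hxz⟩) ?_ ?_
  · refine (hc₁ i).mono ?_
    rintro x ⟨⟨-, hx⟩, hxR⟩
    exact ⟨hxR, by simpa [hxR] using hx⟩
  · refine (hc₂ i).mono ?_
    rintro x ⟨⟨-, hx⟩, hxR⟩
    exact ⟨hxR, by simpa [hxR] using hx⟩

/-- In a critical digraph every vertex has at least two out-neighbours: otherwise it could be given
a colour different from that of its only out-neighbour. -/
theorem IsFourCritical.exists_adj_ne {D : Digraph V} (hD : D.IsFourCritical) (hL : D.Loopless)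
    (v w : V) :
    ∃ x, D.Adj v x ∧ x ≠ w := by
  classical
  by_contra! h
  obtain ⟨c, hc⟩ := hD.2 {v}ᶜ (fun e => by
    have : v ∈ ({v} : Set V)ᶜ := e ▸ Set.mem_univ v
    exact this rfl)
  obtain ⟨j, hj⟩ : ∃ j : Fin 3, j ≠ c w := exists_ne _
  refine hD.1 ⟨Function.update c v j, fun i => ?_⟩
  have h₁ := noClosedWalk_update (y := v) hc (j := j) (fun hv => by
    obtain ⟨x, hx, -⟩ := TransGen.head'_iff.1 hv
    obtain rfl := h x hx.2.2
    rcases hx.2.1 with rfl | hxS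
    · exact hL _ hx.2.2
    · exact hj hxS.2.symm) i
  refine h₁.mono ?_
  rintro x ⟨-, hx⟩
  refine ⟨?_, hx⟩
  by_cases hxv : x = v <;> simp [hxv]

/-- Adding an ear to a strongly connected set of vertices keeps it strongly connected. -/
theorem StrongOn.union_ear {D : Digraph V} {S : Set V} (hS : D.StrongOn S) {s m : V}
    (hs : s ∈ S) (hm : m ∈ S) {t : List V} (ht : (s :: (t ++ [m])).IsChain D.Adj) :
    D.StrongOn (S ∪ {x | x ∈ t}) := by
  have hout : ∀ x ∈ t, ReflTransGen (D.RelOn (S ∪ {x | x ∈ t})) x m := by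
    intro x hx
    refine reach_mono ?_ (reach_of_isChain (q := []) (List.isChain_of_isChain_cons ht) hx)
    rintro z (hz | rfl)
    exacts [Or.inr hz, Or.inl hm]
  have hin : ∀ x ∈ t, ReflTransGen (D.RelOn (S ∪ {x | x ∈ t})) s x := by
    intro x hx
    obtain ⟨t₁, t₂, rfl⟩ := List.append_of_mem hx
    rw [List.append_assoc, List.cons_append, ← List.cons_append] at ht
    refine reach_mono ?_ (reach_of_isChain ht (List.mem_cons_self ..))
    rintro z (hz | rfl)
    · rcases List.mem_cons.1 hz with rfl | hz
      · exact Or.inl hs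
      · exact Or.inr (by simp [hz])
    · exact Or.inr (by simp)
  have hSS : ∀ a ∈ S, ∀ b ∈ S, ReflTransGen (D.RelOn (S ∪ {x | x ∈ t})) a b :=
    fun a ha b hb => reach_mono Set.subset_union_left (hS a ha b hb)
  rintro a (ha | ha) b (hb | hb)
  · exact hSS a ha b hb
  · exact (hSS a ha s hs).trans (hin b hb)
  · exact (hout a ha).trans (hSS m hm b hb)
  · exact ((hout a ha).trans (hSS m hm s hs)).trans (hin b hb)

/-- A strongly connected digraph in which every vertex has two out-neighbours has a vertex whose
deletion leaves it strongly connected. Any ear attached to a maximal strongly connected proper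
subset `S` must cover all other vertices; if the ear has several vertices, then a second
out-neighbour of its first vertex yields a shorter ear. -/
theorem exists_strongOn_compl [Finite V] {D : Digraph V} (hL : D.Loopless)
    (hS : D.StrongOn Set.univ) (hdeg : ∀ v w, ∃ x, D.Adj v x ∧ x ≠ w) [Nontrivial V] :
    ∃ y, D.StrongOn {y}ᶜ := by
  obtain ⟨v₀⟩ : Nonempty V := inferInstance
  obtain ⟨S, -, hmax⟩ := Set.Finite.exists_le_maximal
    (s := {S : Set V | D.StrongOn S ∧ S.Nonempty ∧ S ≠ Set.univ}) (Set.toFinite _) (a := {v₀}) (by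
      refine ⟨?_, by simp, ?_⟩
      · rintro a rfl b rfl
        exact .refl
      · intro e
        obtain ⟨w, hw⟩ := exists_ne v₀
        exact hw (show w ∈ ({v₀} : Set V) from e ▸ Set.mem_univ w))
  obtain ⟨⟨hSs, ⟨s₀, hs₀⟩, hSne⟩, hmax⟩ := hmax
  have hcover : ∀ s ∈ S, ∀ m ∈ S, ∀ w t, w ∉ S → (s :: (w :: t ++ [m])).IsChain D.Adj →
      S ∪ {x | x ∈ w :: t} = Set.univ := by
    intro s hs m hm w t hw hc
    by_contra hne
    exact hw (hmax ⟨hSs.union_ear hs hm hc, ⟨s₀, Or.inl hs₀⟩, hne⟩ Set.subset_union_left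
      (Or.inr (List.mem_cons_self ..)))
  obtain ⟨z, hz⟩ := (Set.ne_univ_iff_exists_notMem S).1 hSne
  obtain ⟨s, w₀, -, hs, hw, hsw, -⟩ := exists_first_exit (hS s₀ trivial z trivial) hs₀ hz
  obtain ⟨w, hw₀, m, hm, q, hc, hn, hq⟩ := exists_path_between (S := {w₀}) (M := S)
    (hS w₀ trivial s trivial) rfl hs (by simpa using hw)
  obtain rfl : w = w₀ := hw₀
  have hc := isChain_adj_of_relOn hc
  have huniv := hcover s hs m hm w q hw (by simpa using ⟨hsw.2.2, hc⟩)
  cases q with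
  | nil =>
    refine ⟨w, ?_⟩
    have : ({w}ᶜ : Set V) = S := by
      ext x
      have hx : x ∈ S ∪ {x | x ∈ [w]} := huniv ▸ Set.mem_univ x
      constructor
      · intro h
        exact hx.resolve_right (by simpa using h)
      · rintro h rfl
        exact hw h
    rw [this]
    exact hSs
  | cons w₂ q =>
    exfalso
    obtain ⟨x, hwx, hx⟩ := hdeg w w₂
    have hxw : x ≠ w := fun e => hL w (e ▸ hwx)
    have hw₂ : w₂ ∉ S := (hq w₂ (by simp)).2
    have hw₂w : w₂ ≠ w := (hq w₂ (by simp)).1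
    by_cases hxS : x ∈ S
    · have := hcover s hs x hxS w [] hw (by simpa using ⟨hsw.2.2, hwx⟩)
      have h₂ : w₂ ∈ S ∪ {x | x ∈ [w]} := this ▸ Set.mem_univ w₂
      rcases h₂ with h₂ | h₂
      · exact hw₂ h₂
      · exact hw₂w (by simpa using h₂)
    have hx' : x ∈ S ∪ {x | x ∈ w :: w₂ :: q} := huniv ▸ Set.mem_univ x
    have hxq : x ∈ q := by
      rcases hx' with h | h
      · exact absurd h hxS
      · simpa [hxw, hx] using h
    obtain ⟨q₁, q₂, rfl⟩ := List.append_of_mem hxq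
    have hc₂ : (x :: (q₂ ++ [m])).IsChain D.Adj := by
      have e : w :: (w₂ :: (q₁ ++ x :: q₂) ++ [m]) = (w :: w₂ :: q₁) ++ x :: (q₂ ++ [m]) := by simp
      rw [e] at hc
      exact (List.isChain_append.1 hc).2.1
    have := hcover s hs m hm w (x :: q₂) hw (by simpa using ⟨hsw.2.2, hwx, hc₂⟩)
    have h₂ : w₂ ∈ S ∪ {z | z ∈ w :: x :: q₂} := this ▸ Set.mem_univ w₂
    rcases h₂ with h₂ | h₂
    · exact hw₂ h₂
    · have hn₂ := (List.nodup_cons.1 (List.nodup_cons.1 hn).2).1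
      rcases List.mem_cons.1 h₂ with h₂ | h₂
      · exact hw₂w h₂
      · exact hn₂ (by
          rcases List.mem_cons.1 h₂ with rfl | h₂
          · simp
          · simp [h₂])

/-! ### Flowers and the digraph `digraphH1` -/

/-- A flower with centre `y`: dicycles `y :: X i` through `y`, any two of which meet only in `y`. -/
structure IsFlower (D : Digraph V) (y : V) {n : ℕ} (X : Fin n → List V) : Prop where
  isDicycle : ∀ i, D.IsDicycle y (X i)
  disjoint : ∀ i j, i ≠ j → (X i).Disjoint (X j)

/-- In a critical digraph `y` lies on a dicycle in each colour of a 3-colouring of the rest. -/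
theorem IsFourCritical.exists_isFlower {D : Digraph V} (hD : D.IsFourCritical) (hL : D.Loopless)
    (y : V) : ∃ X : Fin 3 → List V, D.IsFlower y X := by
  classical
  obtain ⟨c, hc⟩ := hD.2 {y}ᶜ (fun e => by
    have : y ∈ ({y} : Set V)ᶜ := e ▸ Set.mem_univ y
    exact this rfl)
  have h : ∀ j, ∃ l : List V, D.IsDicycle y l ∧ ∀ x ∈ l, c x = j := by
    intro j
    by_contra hj
    refine hD.1 ⟨Function.update c y j, fun i => ?_⟩
    have h₁ := noClosedWalk_update (y := y) hc (j := j) (fun hy => by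
      obtain ⟨l, hl, hlS⟩ := exists_dicycle_of_transGen hL hy
      refine hj ⟨l, hl, fun x hx => ?_⟩
      rcases hlS x hx with rfl | h
      · exact absurd hx hl.notMem
      · exact h.2) i
    refine h₁.mono ?_
    rintro x ⟨-, hx⟩
    refine ⟨?_, hx⟩
    by_cases hxv : x = y <;> simp [hxv]
  choose X hX hXc using h
  exact ⟨X, hX, fun i j hij x hi hj => hij ((hXc i x hi).symm.trans (hXc j x hj))⟩

/-- If `B` is reached from `A` while avoiding `C`, then the last vertex before `C` on a walk from
`B` to `C` lies outside `A` or outside `B`, and so serves as inner vertex of a walk to `C` from `A`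
or from `B`. -/
theorem containsSubdivision_digraphH1_of_reach {D : Digraph V} (hL : D.Loopless) {y a b : V}
    (hy : D.StrongOn {y}ᶜ) {A B C : List V} (hA : D.IsDicycle y A) (hB : D.IsDicycle y B)
    (hC : D.IsDicycle y C) (hAB : A.Disjoint B) (hAC : A.Disjoint C) (hBC : B.Disjoint C)
    (ha : a ∈ A) (hb : b ∈ B) (hab : ReflTransGen (D.RelOn {x | x ≠ y ∧ x ∉ C}) a b) :
    D.ContainsSubdivision digraphH1 := by
  obtain ⟨c, hc⟩ := List.exists_mem_of_ne_nil _ (hC.ne_nil hL)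
  have hby : b ≠ y := fun e => hB.notMem (e ▸ hb)
  have hbc := hy b hby c (fun e => hC.notMem (e ▸ hc))
  obtain ⟨t, d, -, ht, hd, htd, -⟩ := exists_first_exit
    (Q := {x | ReflTransGen (D.RelOn {x | x ≠ y ∧ x ∉ C}) b x}) hbc .refl (fun h => by
      rcases ReflTransGen.cases_tail h with rfl | ⟨_, -, h⟩
      · exact hBC hb hc
      · exact h.2.1.2 hc)
  have htC : t ∉ C := by
    rcases ReflTransGen.cases_tail ht with rfl | ⟨_, -, h⟩
    · exact hBC hb
    · exact h.2.1.2
  have hdC : d ∈ C := by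
    by_contra hdC
    exact hd (ReflTransGen.tail ht ⟨⟨htd.1, htC⟩, ⟨htd.2.1, hdC⟩, htd.2.2⟩)
  by_cases htA : t ∈ A
  · exact hB.containsSubdivision_digraphH1 hC hBC hb ht (hAB htA) htd.2.2 hdC
  · exact hA.containsSubdivision_digraphH1 hC hAC ha (hab.trans ht) htA htd.2.2 hdC

theorem IsFlower.containsSubdivision_digraphH1 {D : Digraph V} (hL : D.Loopless) {y : V}
    (hy : D.StrongOn {y}ᶜ) {X : Fin 3 → List V} (hX : D.IsFlower y X) :
    D.ContainsSubdivision digraphH1 := by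
  obtain ⟨a, ha⟩ := List.exists_mem_of_ne_nil _ ((hX.isDicycle 0).ne_nil hL)
  obtain ⟨b, hb⟩ := List.exists_mem_of_ne_nil _ ((hX.isDicycle 1).ne_nil hL)
  have h01 := hX.disjoint 0 1 (by decide)
  have h02 := hX.disjoint 0 2 (by decide)
  have h12 := hX.disjoint 1 2 (by decide)
  obtain ⟨t, d, hat, ht, hd, htd, -⟩ := exists_first_exit (Q := {x | x ∉ X 1 ∧ x ∉ X 2})
    (hy a (fun e => (hX.isDicycle 0).notMem (e ▸ ha)) b
      (fun e => (hX.isDicycle 1).notMem (e ▸ hb))) ⟨h01 ha, h02 ha⟩ (fun h => h.1 hb)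
  by_cases hd1 : d ∈ X 1
  · refine containsSubdivision_digraphH1_of_reach hL hy (hX.isDicycle 0) (hX.isDicycle 1)
      (hX.isDicycle 2) h01 h02 h12 ha hd1 (ReflTransGen.tail ?_
        ⟨⟨htd.1, ht.2⟩, ⟨htd.2.1, h12 hd1⟩, htd.2.2⟩)
    exact ReflTransGen.mono
      (fun u v h => ⟨⟨h.2.2.1, h.1.2⟩, ⟨h.2.2.2.1, h.2.1.2⟩, h.2.2.2.2⟩) _ _ hat
  · have hd2 : d ∈ X 2 := by
      by_contra hd2
      exact hd ⟨hd1, hd2⟩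
    refine containsSubdivision_digraphH1_of_reach hL hy (hX.isDicycle 0) (hX.isDicycle 2)
      (hX.isDicycle 1) h02 h01 h12.symm ha hd2 (ReflTransGen.tail ?_
        ⟨⟨htd.1, ht.1⟩, ⟨htd.2.1, hd1⟩, htd.2.2⟩)
    exact ReflTransGen.mono
      (fun u v h => ⟨⟨h.2.2.1, h.1.1⟩, ⟨h.2.2.2.1, h.2.1.1⟩, h.2.2.2.2⟩) _ _ hat

/-! ### The regions of a flower -/

/-- The vertices reached from the petal `X i` by walks that avoid the centre `y` and all other
petals. -/
def petalRegion (D : Digraph V) (y : V) {n : ℕ} (X : Fin n → List V) (i : Fin n) : Set V :=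
  {v | ∃ a ∈ X i, ReflTransGen (D.RelOn {x | x ≠ y ∧ ∀ k, k ≠ i → x ∉ X k}) a v}

theorem mem_petalRegion {D : Digraph V} {y : V} {n : ℕ} {X : Fin n → List V} {i : Fin n} {x : V}
    (hx : x ∈ X i) : x ∈ D.petalRegion y X i :=
  ⟨x, hx, .refl⟩

theorem mem_of_reach {D : Digraph V} {S : Set V} {a b : V} (h : ReflTransGen (D.RelOn S) a b)
    (ha : a ∈ S) : b ∈ S := by
  rcases ReflTransGen.cases_tail h with rfl | ⟨_, -, h⟩
  · exact ha
  · exact h.2.1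

theorem exists_last_of_exists {p : V → Prop} :
    ∀ {l : List V}, (∃ x ∈ l, p x) → ∃ l₁ x l₂, l = l₁ ++ x :: l₂ ∧ p x ∧ ∀ z ∈ l₂, ¬ p z
  | [], h => by simp at h
  | a :: l, h => by
    by_cases hl : ∃ x ∈ l, p x
    · obtain ⟨l₁, x, l₂, rfl, hx, h₂⟩ := exists_last_of_exists hl
      exact ⟨a :: l₁, x, l₂, rfl, hx, h₂⟩
    · obtain ⟨x, hx, hpx⟩ := h
      rcases List.mem_cons.1 hx with rfl | hx
      · exact ⟨[], x, l, rfl, hpx, fun z hz hpz => hl ⟨z, hz, hpz⟩⟩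
      · exact absurd ⟨x, hx, hpx⟩ hl

namespace IsFlower

variable {D : Digraph V} {y : V} {n : ℕ} {X : Fin n → List V}

theorem notMem_of_mem_petalRegion (hX : D.IsFlower y X) {i : Fin n} {x : V}
    (hx : x ∈ D.petalRegion y X i) : x ≠ y ∧ ∀ k, k ≠ i → x ∉ X k := by
  obtain ⟨a, ha, h⟩ := hx
  have hS := mem_of_reach h ⟨fun e => (hX.isDicycle i).notMem (e ▸ ha),
    fun k hk h => hX.disjoint k i hk h ha⟩
  exact hS

theorem exists_reach_petalRegion {i : Fin n} {x : V} (hx : x ∈ D.petalRegion y X i) :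
    ∃ a ∈ X i, ReflTransGen (D.RelOn (D.petalRegion y X i)) a x := by
  obtain ⟨a, ha, h⟩ := hx
  refine ⟨a, ha, ?_⟩
  induction h with
  | refl => exact .refl
  | tail h₁ h₂ ih => exact ih.tail ⟨⟨a, ha, h₁⟩, ⟨a, ha, h₁.tail h₂⟩, h₂.2.2⟩

theorem mem_petalRegion_or (hX : D.IsFlower y X) {i : Fin n} {u v : V}
    (hu : u ∈ D.petalRegion y X i) (huv : D.Adj u v) (hv : v ≠ y) :
    v ∈ D.petalRegion y X i ∨ ∃ k, k ≠ i ∧ v ∈ X k := by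
  by_cases h : ∃ k, k ≠ i ∧ v ∈ X k
  · exact Or.inr h
  push Not at h
  have hu' := hX.notMem_of_mem_petalRegion hu
  obtain ⟨a, ha, hau⟩ := hu
  exact Or.inl ⟨a, ha, hau.tail ⟨hu', ⟨hv, h⟩, huv⟩⟩

theorem petalRegion_cover (hL : D.Loopless) (hX : D.IsFlower y X) (hy : D.StrongOn {y}ᶜ)
    (i : Fin n) {x : V} (hx : x ≠ y) : ∃ k, x ∈ D.petalRegion y X k := by
  obtain ⟨a, ha⟩ := List.exists_mem_of_ne_nil _ ((hX.isDicycle i).ne_nil hL)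
  have hax := hy a (fun e => (hX.isDicycle i).notMem (e ▸ ha)) x hx
  induction hax with
  | refl => exact ⟨i, mem_petalRegion ha⟩
  | tail _ h ih =>
    obtain ⟨k, hk⟩ := ih h.1
    rcases hX.mem_petalRegion_or hk h.2.2 hx with h | ⟨j, -, hj⟩
    · exact ⟨k, h⟩
    · exact ⟨j, mem_petalRegion hj⟩

theorem reach_petalRegion_avoiding (hX : D.IsFlower y X) {i k : Fin n} (hik : i ≠ k) :
    D.petalRegion y X i ⊆ {x | x ≠ y ∧ x ∉ X k} := fun _ hx =>
  ⟨(hX.notMem_of_mem_petalRegion hx).1, (hX.notMem_of_mem_petalRegion hx).2 k hik.symm⟩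

theorem disjoint_petalRegion (hX : D.IsFlower y X) (hH : ¬ D.ContainsSubdivision digraphH2)
    {i k : Fin n} (hik : i ≠ k) {x : V} (hi : x ∈ D.petalRegion y X i)
    (hk : x ∈ D.petalRegion y X k) : False := by
  obtain ⟨a, ha, hax⟩ := exists_reach_petalRegion hi
  obtain ⟨b, hb, hbx⟩ := exists_reach_petalRegion hk
  exact hH ((hX.isDicycle i).containsSubdivision_digraphH2 (hX.isDicycle k) (hX.disjoint i k hik) ha
    (reach_mono (hX.reach_petalRegion_avoiding hik) hax) hb
    (reach_mono (hX.reach_petalRegion_avoiding hik.symm) hbx))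

/-- An arc between two regions ends on a petal. -/
theorem mem_petal_of_adj (hX : D.IsFlower y X) (hH : ¬ D.ContainsSubdivision digraphH2)
    {i k : Fin n} (hik : i ≠ k) {u v : V} (hu : u ∈ D.petalRegion y X i)
    (hv : v ∈ D.petalRegion y X k) (huv : D.Adj u v) : v ∈ X k := by
  rcases hX.mem_petalRegion_or hu huv (hX.notMem_of_mem_petalRegion hv).1 with h | ⟨j, -, hj⟩
  · exact (hX.disjoint_petalRegion hH hik h hv).elim
  · by_cases hjk : j = k
    · exact hjk ▸ hj
    · exact ((hX.notMem_of_mem_petalRegion hv).2 j hjk hj).elim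

/-- All arcs entering a petal from outside its region come from the same region. -/
theorem eq_of_adj_petal (hX : D.IsFlower y X) (hH : ¬ D.ContainsSubdivision digraphH2)
    {i j k : Fin n} (hij : i ≠ j) (hkj : k ≠ j) {u w u' w' : V} (hu : u ∈ D.petalRegion y X i)
    (hw : w ∈ X j) (huw : D.Adj u w) (hu' : u' ∈ D.petalRegion y X k) (hw' : w' ∈ X j)
    (huw' : D.Adj u' w') : i = k := by
  by_contra hik
  have key : ∀ {i k : Fin n}, i ≠ j → k ≠ j → i ≠ k → ∀ {u w u' w' : V},
      u ∈ D.petalRegion y X i → w ∈ X j → D.Adj u w → u' ∈ D.petalRegion y X k → w' ∈ X j →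
      D.Adj u' w' → ReflTransGen (D.RelOn {x | x ∈ X j}) w w' → False := by
    intro i k hij hkj hik u w u' w' hu hw huw hu' hw' huw' hww'
    obtain ⟨a, ha, hau⟩ := exists_reach_petalRegion hu
    obtain ⟨b, hb, hbu⟩ := exists_reach_petalRegion hu'
    have hj : ∀ l, l ≠ j → ∀ z ∈ X j, z ≠ y ∧ z ∉ X l := fun l hl z hz =>
      ⟨fun e => (hX.isDicycle j).notMem (e ▸ hz), fun h => hX.disjoint l j hl h hz⟩
    refine hH ((hX.isDicycle i).containsSubdivision_digraphH2 (hX.isDicycle k)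
      (hX.disjoint i k hik) (z := w') ha ?_ hb ?_)
    · refine ((reach_mono (hX.reach_petalRegion_avoiding hik) hau).tail
        ⟨hX.reach_petalRegion_avoiding hik hu, hj k hkj w hw, huw⟩).trans
        (reach_mono (fun z hz => hj k hkj z hz) hww')
    · exact (reach_mono (hX.reach_petalRegion_avoiding (Ne.symm hik)) hbu).tail
        ⟨hX.reach_petalRegion_avoiding (Ne.symm hik) hu', hj i hij w' hw', huw'⟩
  rcases (hX.isDicycle j).reach_or_reach hw hw' with h | h
  · exact key hij hkj hik hu hw huw hu' hw' huw' h
  · exact key hkj hij (Ne.symm hik) hu' hw' huw' hu hw huw h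

/-- A nonempty set of petals that contains every petal whose region sends an arc to one of its
members consists of all petals. -/
theorem eq_univ_of_predClosed (hL : D.Loopless) (hX : D.IsFlower y X) (hy : D.StrongOn {y}ᶜ)
    (hH : ¬ D.ContainsSubdivision digraphH2) {T : Set (Fin n)} (hT : T.Nonempty)
    (hcl : ∀ j ∈ T, ∀ i, i ≠ j → ∀ u ∈ D.petalRegion y X i, ∀ w ∈ X j, D.Adj u w → i ∈ T) :
    T = Set.univ := by
  obtain ⟨j, hj⟩ := hT
  by_contra hne
  obtain ⟨i, hi⟩ := (Set.ne_univ_iff_exists_notMem T).1 hne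
  obtain ⟨a, ha⟩ := List.exists_mem_of_ne_nil _ ((hX.isDicycle i).ne_nil hL)
  obtain ⟨b, hb⟩ := List.exists_mem_of_ne_nil _ ((hX.isDicycle j).ne_nil hL)
  obtain ⟨t, d, -, ht, hd, htd, -⟩ := exists_first_exit
    (Q := {x | ∀ k ∈ T, x ∉ D.petalRegion y X k})
    (hy a (fun e => (hX.isDicycle i).notMem (e ▸ ha)) b
      (fun e => (hX.isDicycle j).notMem (e ▸ hb)))
    (fun k hk h => (hX.notMem_of_mem_petalRegion h).2 i (fun e => hi (e ▸ hk)) ha)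
    (fun h => h j hj (mem_petalRegion hb))
  obtain ⟨l, hl⟩ := hX.petalRegion_cover hL hy i htd.1
  have : ∃ k ∈ T, d ∈ D.petalRegion y X k := by
    by_contra! h
    exact hd h
  obtain ⟨k, hk, hdk⟩ := this
  have hlk : l ≠ k := fun e => ht k hk (e ▸ hl)
  exact ht l (hcl k hk l hlk t hl d (hX.mem_petal_of_adj hH hlk hl hdk htd.2.2) htd.2.2) hl

/-- Let an arc from another region `i` enter the petal `X k = p ++ h :: s` in `h`. Then no walk that
avoids `h` and the region `i` leads from `p` to the centre `y`: it would yield a dicycle through `y`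
avoiding `h` and the petal `X i`, and `h` is reached both from this dicycle, along `p`, and from
`X i`. -/
theorem not_reach_center (hX : D.IsFlower y X)
    (hH : ¬ D.ContainsSubdivision digraphH2) {i k : Fin n} (hik : i ≠ k) {p s : List V} {h u w : V}
    (hk : X k = p ++ h :: s) (hu : u ∈ D.petalRegion y X i) (huh : D.Adj u h) (hw : w ∈ p)
    (hwy : ReflTransGen (D.RelOn {x | x ≠ h ∧ x ∉ D.petalRegion y X i}) w y) : False := by
  have hC := hX.isDicycle k
  rw [hk] at hC
  have hkr : ∀ x ∈ p ++ h :: s, x ∉ D.petalRegion y X i := fun x hx hxi =>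
    (hX.notMem_of_mem_petalRegion hxi).2 k (Ne.symm hik) (hk ▸ hx)
  have hhp : h ∉ p := fun hp => (List.nodup_append'.1 hC.nodup).2.2 hp (by simp)
  have hky : ∀ x ∈ p ++ h :: s, x ≠ y := fun x hx e => hC.notMem (e ▸ hx)
  cases p with
  | nil => simp at hw
  | cons x p =>
    have hchain : ((x :: p) ++ h :: s).IsChain D.Adj := List.isChain_of_isChain_cons hC.1.1
    have hxw : ReflTransGen (D.RelOn {x | x ≠ h ∧ x ∉ D.petalRegion y X i}) x w := by
      rcases List.mem_cons.1 hw with rfl | hw'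
      · exact .refl
      obtain ⟨p₁, p₂, rfl⟩ := List.append_of_mem hw'
      have hchain' : ((x :: p₁) ++ w :: (p₂ ++ h :: s)).IsChain D.Adj := by simpa using hchain
      refine reach_mono ?_ (reach_of_isChain hchain' (List.mem_cons_self ..))
      intro z hz
      have hz' : z ∈ x :: (p₁ ++ w :: p₂) := by
        rcases hz with hz | rfl
        · rcases List.mem_cons.1 hz with rfl | hz
          · simp
          · simp [hz]
        · exact hw
      exact ⟨fun e => hhp (e ▸ hz'), hkr z (List.mem_append_left _ hz')⟩
    have hyx : D.Adj y x := by
      have := hC.1.1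
      rw [List.cons_append, List.isChain_cons_cons] at this
      exact this.1
    obtain ⟨l, hl, hlS⟩ := exists_dicycle_of_reach hyx (hky x (by simp)) (hxw.trans hwy)
    obtain ⟨a, ha, hau⟩ := exists_reach_petalRegion hu
    have hri : D.petalRegion y X i ⊆ {z | z ≠ y ∧ z ∉ x :: l} := fun z hz =>
      ⟨(hX.notMem_of_mem_petalRegion hz).1, fun hzl => (hlS z hzl).2 hz⟩
    refine hH (hl.containsSubdivision_digraphH2 (hX.isDicycle i) (z := h) ?_
      (List.mem_cons_self ..) ?_ ha ?_)
    · exact fun z hz hz' => (hlS z hz).2 (mem_petalRegion hz')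
    · refine reach_mono ?_ (reach_of_isChain hchain (List.mem_cons_self ..))
      intro z hz
      have hz' : z ∈ (x :: p) ++ h :: s := by
        rcases hz with hz | rfl
        · exact List.mem_append_left _ hz
        · simp
      exact ⟨hky z hz', fun h' => hkr z hz' (mem_petalRegion h')⟩
    · exact (reach_mono hri hau).tail ⟨hri hu, ⟨hky h (by simp), fun h' => (hlS h h').1 rfl⟩, huh⟩

end IsFlower

/-- The gate of the petal `X k`: its last vertex `h` dominated by a vertex outside the region of
`X k`. The petal is `p ++ h :: s`, and `i` is the region from which `h` is dominated. -/
structure IsGate (D : Digraph V) (y : V) {n : ℕ} (X : Fin n → List V) (k : Fin n) (h : V)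
    (p s : List V) (i : Fin n) : Prop where
  eq : X k = p ++ h :: s
  ne : i ≠ k
  adj : ∃ u ∈ D.petalRegion y X i, D.Adj u h
  last : ∀ z ∈ s, ∀ j, j ≠ k → ∀ u ∈ D.petalRegion y X j, ¬ D.Adj u z

namespace IsFlower

variable {D : Digraph V} {y : V} {n : ℕ} {X : Fin n → List V}

theorem exists_isGate (hL : D.Loopless) (hX : D.IsFlower y X) (hy : D.StrongOn {y}ᶜ)
    (hH : ¬ D.ContainsSubdivision digraphH2) (hn : 2 ≤ n) (k : Fin n) :
    ∃ h p s i, D.IsGate y X k h p s i := by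
  have : ∃ w ∈ X k, ∃ i, i ≠ k ∧ ∃ u ∈ D.petalRegion y X i, D.Adj u w := by
    by_contra! h
    have huniv := hX.eq_univ_of_predClosed hL hy hH (T := {k}) ⟨k, rfl⟩ (by
      rintro j rfl i hij u hu w hw huw
      exact absurd huw (h w hw i hij u hu))
    have : Nontrivial (Fin n) := Fin.nontrivial_iff_two_le.2 hn
    obtain ⟨l, hl⟩ := exists_ne k
    exact hl (show l ∈ ({k} : Set (Fin n)) from huniv ▸ Set.mem_univ l)
  obtain ⟨p, h, s, he, ⟨i, hi, hu⟩, hlast⟩ := exists_last_of_exists this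
  exact ⟨h, p, s, i, he, hi, hu, fun z hz j hj u hu huz => hlast z hz ⟨j, hj, u, hu, huz⟩⟩

theorem enter_petalRegion (hX : D.IsFlower y X) (hH : ¬ D.ContainsSubdivision digraphH2)
    {k i j : Fin n} {h u w : V} {p s : List V} (hg : D.IsGate y X k h p s i) (hj : j ≠ k)
    (hu : u ∈ D.petalRegion y X j) (hw : w ∈ D.petalRegion y X k) (huw : D.Adj u w) :
    j = i ∧ (w = h ∨ w ∈ p) := by
  obtain ⟨v, hv, hvh⟩ := hg.adj
  have hwX := hX.mem_petal_of_adj hH hj hu hw huw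
  refine ⟨hX.eq_of_adj_petal hH hj hg.ne hu hwX huw hv (by simp [hg.eq]) hvh, ?_⟩
  rw [hg.eq] at hwX
  rcases List.mem_append.1 hwX with h | h
  · exact Or.inr h
  rcases List.mem_cons.1 h with h | h
  · exact Or.inl h
  · exact absurd huw (hg.last w h j hj u hu)

/-- A 3-colouring of `D` whose restriction to each region together with `y` is acyclic, and in which
no gate has the colour of `y`, has no monochromatic closed walk through `y`. -/
theorem not_transGen_center (hL : D.Loopless) (hX : D.IsFlower y X) (hy : D.StrongOn {y}ᶜ)
    (hH : ¬ D.ContainsSubdivision digraphH2) {h : Fin n → V} {p s : Fin n → List V}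
    {i : Fin n → Fin n} (hg : ∀ k, D.IsGate y X k (h k) (p k) (s k) (i k)) (k₀ : Fin n)
    {M : Set V} (hM : ∀ k, D.NoClosedWalk (insert y (D.petalRegion y X k) ∩ M))
    (hhM : ∀ k, y ∈ M → h k ∉ M) : ¬ TransGen (D.RelOn M) y y := by
  intro hyy
  obtain ⟨v, hyv, hvy⟩ := TransGen.head'_iff.1 hyy
  -- The part of the walk after its last entry into a region stays in this region.
  have key : ∀ v, ReflTransGen (D.RelOn M) v y → v = y ∨ ∃ k, v ∈ D.petalRegion y X k ∧
      ReflTransGen (D.RelOn (insert y (D.petalRegion y X k) ∩ M)) v y := by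
    intro v hv
    induction hv using ReflTransGen.head_induction_on with
    | refl => exact Or.inl rfl
    | @head v v' hvv' _ ih =>
      by_cases hvy : v = y
      · exact Or.inl hvy
      obtain ⟨j, hj⟩ := hX.petalRegion_cover hL hy k₀ hvy
      rcases ih with rfl | ⟨k, hk, hky⟩
      · exact Or.inr ⟨j, hj, .single ⟨⟨Or.inr hj, hvv'.1⟩, ⟨Or.inl rfl, hvv'.2.1⟩, hvv'.2.2⟩⟩
      by_cases hjk : j = k
      · subst hjk
        exact Or.inr ⟨j, hj, .head ⟨⟨Or.inr hj, hvv'.1⟩, ⟨Or.inr hk, hvv'.2.1⟩, hvv'.2.2⟩ hky⟩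
      exfalso
      obtain ⟨rfl, hv'⟩ := hX.enter_petalRegion hH (hg k) hjk hj hk hvv'.2.2
      have hhk := hhM k hyv.1
      obtain ⟨u, hu, huh⟩ := (hg k).adj
      rcases hv' with rfl | hv'
      · exact hhk hvv'.2.1
      refine hX.not_reach_center hH (hg k).ne (hg k).eq hu huh hv' (reach_mono ?_ hky)
      rintro x ⟨hx, hxM⟩
      refine ⟨fun e => hhk (e ▸ hxM), fun hxi => ?_⟩
      rcases hx with rfl | hx
      · exact (hX.notMem_of_mem_petalRegion hxi).1 rfl
      · exact hX.disjoint_petalRegion hH (hg k).ne hxi hx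
  rcases key v hvy with rfl | ⟨k, hk, hky⟩
  · exact hL _ hyv.2.2
  · exact hM k y (TransGen.head' ⟨⟨Or.inl rfl, hyv.1⟩, ⟨Or.inr hk, hyv.2.1⟩, hyv.2.2⟩ hky)

/-- A closed walk that avoids `y` and is not contained in one region visits all the regions, and it
passes through the gate of each petal. -/
theorem gate_mem_of_closedWalk (hL : D.Loopless) (hX : D.IsFlower y X) (hy : D.StrongOn {y}ᶜ)
    (hH : ¬ D.ContainsSubdivision digraphH2) (hn : 3 ≤ n) {h : Fin n → V} {p s : Fin n → List V}
    {i : Fin n → Fin n} (hg : ∀ k, D.IsGate y X k (h k) (p k) (s k) (i k))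
    {C : Set V} (hC : D.StrongOn C) (hyC : y ∉ C) {v : V} (hv : v ∈ C)
    (hCk : ∀ k, ¬ C ⊆ D.petalRegion y X k) (k : Fin n) : h k ∈ C := by
  have hcov : ∀ x ∈ C, ∃ j, x ∈ D.petalRegion y X j := fun x hx =>
    hX.petalRegion_cover hL hy k (fun e => hyC (e ▸ hx))
  -- Every visited region is entered from another region.
  have henter : ∀ k, (∃ w ∈ C, w ∈ D.petalRegion y X k) → ∃ u x, u ∈ C ∧ x ∈ C ∧
      u ∈ D.petalRegion y X (i k) ∧ x ∈ D.petalRegion y X k ∧ D.Adj u x ∧ (x = h k ∨ x ∈ p k) := by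
    rintro k ⟨w, hw, hwk⟩
    obtain ⟨w', hw', hwk'⟩ := Set.not_subset.1 (hCk k)
    obtain ⟨u, x, -, hu, hx, hux, -⟩ := exists_first_exit (Q := (D.petalRegion y X k)ᶜ)
      (hC w' hw' w hw) hwk' (fun h => h hwk)
    obtain ⟨j, hj⟩ := hcov u hux.1
    have hjk : j ≠ k := fun e => hu (e ▸ hj)
    have hx : x ∈ D.petalRegion y X k := by simpa using hx
    obtain ⟨rfl, hx'⟩ := hX.enter_petalRegion hH (hg k) hjk hj hx hux.2.2
    exact ⟨u, x, hux.1, hux.2.1, hj, hx, hux.2.2, hx'⟩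
  have hpred : ∀ k j, j ≠ k → ∀ u ∈ D.petalRegion y X j, ∀ w ∈ X k, D.Adj u w → j = i k :=
    fun k j hjk u hu w hw huw =>
      (hX.enter_petalRegion hH (hg k) hjk hu (mem_petalRegion hw) huw).1
  have hall : {k | ∃ w ∈ C, w ∈ D.petalRegion y X k} = Set.univ := by
    refine hX.eq_univ_of_predClosed hL hy hH ?_ ?_
    · obtain ⟨j, hj⟩ := hcov v hv
      exact ⟨j, v, hv, hj⟩
    · intro k hk j hjk u hu w hw huw
      obtain rfl := hpred k j hjk u hu w hw huw
      obtain ⟨u', -, hu', -, hu'i, -⟩ := henter k hk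
      exact ⟨u', hu', hu'i⟩
  obtain ⟨u, x, hu, hx, hui, hxk, hux, hx'⟩ := henter k
    (show k ∈ {k | ∃ w ∈ C, w ∈ D.petalRegion y X k} from hall ▸ Set.mem_univ k)
  by_contra hhC
  have hxp : x ∈ p k := hx'.resolve_left (fun e => hhC (e ▸ hx))
  have huk : u ∉ D.petalRegion y X k := fun huk =>
    hX.disjoint_petalRegion hH (hg k).ne hui huk
  obtain ⟨t, b, hxt, ht, hb, htb, -⟩ := exists_first_exit (hC x hx u hu) hxk huk
  have hby : b ≠ y := fun e => hyC (e ▸ htb.2.1)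
  obtain ⟨j, hjk, hbj⟩ := (hX.mem_petalRegion_or ht htb.2.2 hby).resolve_left hb
  -- Two regions that precede each other would be the only ones.
  have hji : j ≠ i k := by
    intro e
    have huniv := hX.eq_univ_of_predClosed hL hy hH (T := {k, j}) ⟨k, Or.inl rfl⟩ (by
      rintro l hl m hml z hz w hw hzw
      rcases hl with rfl | rfl
      · exact Or.inr ((hpred l m hml z hz w hw hzw).trans e.symm)
      · exact Or.inl ((hpred l m hml z hz w hw hzw).trans
          (hpred l k (Ne.symm hjk) t ht b hbj htb.2.2).symm))
    have hcard : (Set.univ : Set (Fin n)).ncard ≤ 2 := 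
      huniv ▸ (Set.ncard_insert_le k {j}).trans (by simp)
    rw [Set.ncard_univ, Nat.card_eq_fintype_card, Fintype.card_fin] at hcard
    omega
  obtain ⟨z, hz, hzh⟩ := (hg k).adj
  refine hX.not_reach_center hH (hg k).ne (hg k).eq hz hzh hxp (w := x) ?_
  have hin : ∀ w ∈ D.petalRegion y X k, w ∈ C → w ≠ h k ∧ w ∉ D.petalRegion y X (i k) :=
    fun w hw hwC => ⟨fun e => hhC (e ▸ hwC), fun hwi =>
      hX.disjoint_petalRegion hH (hg k).ne hwi hw⟩
  have hout : ∀ w, w ∈ X j ∨ w = y → w ≠ h k ∧ w ∉ D.petalRegion y X (i k) := by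
    have hhk : h k ∈ X k := by simp [(hg k).eq]
    rintro w (hw | rfl)
    · exact ⟨fun e => hX.disjoint j k hjk hw (e ▸ hhk), fun hwi =>
        (hX.notMem_of_mem_petalRegion hwi).2 j hji hw⟩
    · exact ⟨fun e => (hX.isDicycle k).notMem (e ▸ hhk), fun hwi =>
        (hX.notMem_of_mem_petalRegion hwi).1 rfl⟩
  refine ReflTransGen.trans (b := t) ?_ (.head
    ⟨hin t ht htb.1, hout b (Or.inl hbj), htb.2.2⟩
    (reach_mono hout ((hX.isDicycle j).reach_center hbj)))
  exact ReflTransGen.mono (fun a c h => ⟨hin a h.1 h.2.2.1, hin c h.2.1 h.2.2.2.1, h.2.2.2.2⟩)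
    _ _ hxt

end IsFlower

/-! ### The digraph `digraphH2` -/

namespace IsFlower

variable {D : Digraph V} {y : V} {n : ℕ} {X : Fin n → List V}

/-- If no flower with the same centre has more petals, then the region of a petal together with `y`
has a 3-colouring in which a given vertex `h` has a colour different from that of `y`: otherwise `y`
could not be recoloured with either of the two other colours, and would lie on two dicycles in the
region that meet only in `y`; these could replace the petal `X k`. -/
theorem exists_coloring_region (hL : D.Loopless) (hD : D.IsFourCritical) (hX : D.IsFlower y X)
    (hn : 2 ≤ n) (hmax : ¬ ∃ X' : Fin (n + 1) → List V, D.IsFlower y X') (k : Fin n) {h : V}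
    (hh : h ≠ y) : ∃ c : V → Fin 3,
      (∀ i, D.NoClosedWalk (insert y (D.petalRegion y X k) ∩ c ⁻¹' {i})) ∧ c y ≠ c h := by
  classical
  obtain ⟨c, hc⟩ := hD.2 (insert y (D.petalRegion y X k)) (by
    intro e
    have : Nontrivial (Fin n) := Fin.nontrivial_iff_two_le.2 hn
    obtain ⟨l, hl⟩ := exists_ne k
    obtain ⟨a, ha⟩ := List.exists_mem_of_ne_nil _ ((hX.isDicycle l).ne_nil hL)
    rcases (show a ∈ insert y (D.petalRegion y X k) from e ▸ Set.mem_univ a) with rfl | h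
    · exact (hX.isDicycle l).notMem ha
    · exact (hX.notMem_of_mem_petalRegion h).2 l hl ha)
  by_cases hcy : c y = c h
  swap
  · exact ⟨c, hc, hcy⟩
  by_contra hno
  have hcyc : ∀ j, j ≠ c y → ∃ l : List V, D.IsDicycle y l ∧
      (∀ x ∈ l, x ∈ D.petalRegion y X k) ∧ ∀ x ∈ l, c x = j := by
    intro j hj
    by_contra hl
    refine hno ⟨Function.update c y j, noClosedWalk_update
      (fun i => (hc i).mono (Set.inter_subset_inter_left _ (Set.subset_insert _ _))) ?_, ?_⟩
    · intro hy
      obtain ⟨l, hl', hlS⟩ := exists_dicycle_of_transGen hL hy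
      have hlS' : ∀ x ∈ l, x ∈ D.petalRegion y X k ∩ c ⁻¹' {j} := fun x hx =>
        (hlS x hx).resolve_left (fun e => hl'.notMem (e ▸ hx))
      exact hl ⟨l, hl', fun x hx => (hlS' x hx).1, fun x hx => (hlS' x hx).2⟩
    · rw [Function.update_self, Function.update_of_ne hh, ← hcy]
      exact hj
  obtain ⟨j₁, j₂, h₁, h₂, h₁₂⟩ : ∃ j₁ j₂ : Fin 3, j₁ ≠ c y ∧ j₂ ≠ c y ∧ j₁ ≠ j₂ := by
    generalize c y = a
    revert a
    decide
  obtain ⟨l₁, hl₁, hr₁, hc₁⟩ := hcyc j₁ h₁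
  obtain ⟨l₂, hl₂, hr₂, hc₂⟩ := hcyc j₂ h₂
  have hd : ∀ l : List V, (∀ x ∈ l, x ∈ D.petalRegion y X k) → ∀ i, i ≠ k → l.Disjoint (X i) :=
    fun l hl i hi x hx hx' => (hX.notMem_of_mem_petalRegion (hl x hx)).2 i hi hx'
  have hd₁₂ : l₁.Disjoint l₂ := fun x hx hx' => h₁₂ ((hc₁ x hx).symm.trans (hc₂ x hx'))
  have hd₂ : ∀ i, l₂.Disjoint (Function.update X k l₁ i) := by
    intro i
    by_cases hi : i = k
    · subst hi
      simpa using hd₁₂.symm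
    · simpa [hi] using hd l₂ hr₂ i hi
  refine hmax ⟨Fin.cons l₂ (Function.update X k l₁), ?_, ?_⟩
  · intro i
    refine Fin.cases ?_ (fun i => ?_) i
    · simpa using hl₂
    · rw [Fin.cons_succ]
      by_cases hi : i = k
      · subst hi
        simpa using hl₁
      · simpa [hi] using hX.isDicycle i
  · intro i j
    refine Fin.cases ?_ (fun i => ?_) i <;> refine Fin.cases ?_ (fun j => ?_) j
    · simp
    · intro _
      simpa using hd₂ j
    · intro _
      simpa using (hd₂ i).symm
    · intro hij
      have hij : i ≠ j := fun e => hij (e ▸ rfl)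
      rw [Fin.cons_succ, Fin.cons_succ]
      by_cases hi : i = k
      · subst hi
        simpa [hij.symm] using hd l₁ hr₁ j hij.symm
      · by_cases hj : j = k
        · subst hj
          simpa [hi] using (hd l₁ hr₁ i hi).symm
        · simpa [hi, hj] using hX.disjoint i j hij

/-- The centre of a flower with at least three petals and with the maximum number of petals
yields a subdivision of `digraphH2`: otherwise the colourings of the regions can be combined, with
`y` of colour `0`, one gate of colour `1` and all other gates of colour `2`. -/
theorem containsSubdivision_digraphH2 (hL : D.Loopless) (hD : D.IsFourCritical)
    (hy : D.StrongOn {y}ᶜ) (hX : D.IsFlower y X) (hn : 3 ≤ n)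
    (hmax : ¬ ∃ X' : Fin (n + 1) → List V, D.IsFlower y X') :
    D.ContainsSubdivision digraphH2 := by
  classical
  by_contra hH
  have hgate := hX.exists_isGate hL hy hH (by omega)
  choose h p s i hg using hgate
  have hhX : ∀ k, h k ∈ X k := fun k => by simp [(hg k).eq]
  have hhy : ∀ k, h k ≠ y := fun k e => (hX.isDicycle k).notMem (e ▸ hhX k)
  let k₀ : Fin n := ⟨0, by omega⟩
  let k₁ : Fin n := ⟨1, by omega⟩
  have hk : k₁ ≠ k₀ := by simp [k₀, k₁]
  have hperm : ∀ a b d : Fin 3, a ≠ b → d ≠ 0 → ∃ σ : Equiv.Perm (Fin 3), σ a = 0 ∧ σ b = d := by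
    decide
  have hcol : ∀ k, ∃ c : V → Fin 3,
      (∀ i, D.NoClosedWalk (insert y (D.petalRegion y X k) ∩ c ⁻¹' {i})) ∧ c y = 0 ∧
      c (h k) = if k = k₀ then 1 else 2 := by
    intro k
    obtain ⟨c, hc, hne⟩ := hX.exists_coloring_region hL hD (by omega) hmax k (hhy k)
    obtain ⟨σ, h₁, h₂⟩ := hperm (c y) (c (h k)) (if k = k₀ then 1 else 2) hne
      (by split_ifs <;> decide)
    refine ⟨fun x => σ (c x), fun j => (hc (σ.symm j)).mono ?_, h₁, h₂⟩
    rintro x ⟨hx, hxj⟩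
    exact ⟨hx, (Equiv.eq_symm_apply σ).2 hxj⟩
  choose c hc hcy hch using hcol
  have hidx : ∀ x, ∃ k, x ≠ y → x ∈ D.petalRegion y X k := by
    intro x
    by_cases hx : x = y
    · exact ⟨k₀, fun h => absurd hx h⟩
    · obtain ⟨k, hk⟩ := hX.petalRegion_cover hL hy k₀ hx
      exact ⟨k, fun _ => hk⟩
  choose idx hidx using hidx
  let g : V → Fin 3 := fun x => c (idx x) x
  have hg_eq : ∀ k, ∀ x ∈ insert y (D.petalRegion y X k), g x = c k x := by
    rintro k x (rfl | hx)
    · exact (hcy _).trans (hcy _).symm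
    · have hxy := (hX.notMem_of_mem_petalRegion hx).1
      have : idx x = k := by
        by_contra hne
        exact hX.disjoint_petalRegion hH hne (hidx x hxy) hx
      simp only [g, this]
  have hgh : ∀ k, g (h k) = if k = k₀ then 1 else 2 := fun k =>
    (hg_eq k _ (Or.inr (mem_petalRegion (hhX k)))).trans (hch k)
  have hgy : g y = 0 := hcy _
  refine hD.1 ⟨g, fun j => ?_⟩
  rw [Set.univ_inter]
  have hM : ∀ k, D.NoClosedWalk (insert y (D.petalRegion y X k) ∩ g ⁻¹' {j}) := by
    intro k
    refine (hc k j).mono ?_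
    rintro x ⟨hx, hxj⟩
    exact ⟨hx, (hg_eq k x hx).symm.trans hxj⟩
  have hyy := hX.not_transGen_center hL hy hH hg k₀ hM (by
    intro k hy' hh
    have e : g (h k) = g y := hh.trans hy'.symm
    rw [hgh, hgy] at e
    split_ifs at e <;> simp at e)
  intro v hv
  have hv' := transGen_avoiding hyy hv
  set M := g ⁻¹' {j} \ {y} with hMdef
  -- The strong component of `v` in its colour class.
  set C : Set V := {x | ReflTransGen (D.RelOn M) v x ∧ ReflTransGen (D.RelOn M) x v} with hCdef
  have hvM : v ∈ M := by
    obtain ⟨w, hw, -⟩ := TransGen.head'_iff.1 hv'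
    exact hw.1
  have hCM : ∀ x ∈ C, x ∈ M := fun x hx => mem_of_reach hx.1 hvM
  have hvC : v ∈ C := ⟨.refl, .refl⟩
  have hreach : ∀ a b, ReflTransGen (D.RelOn M) a b → a ∈ C → b ∈ C →
      ReflTransGen (D.RelOn C) a b := by
    intro a b hab ha hb
    induction hab using ReflTransGen.head_induction_on with
    | refl => exact .refl
    | @head a a' haa' ha'b ih =>
      have ha' : a' ∈ C := ⟨ha.1.tail haa', ha'b.trans hb.2⟩
      exact .head ⟨ha, ha', haa'.2.2⟩ (ih ha')
  have hC : D.StrongOn C := fun a ha b hb => hreach a b (ha.2.trans hb.1) ha hb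
  have hCk : ∀ k, ¬ C ⊆ D.petalRegion y X k := by
    intro k hCk
    obtain ⟨w, hvw, hwv⟩ := TransGen.head'_iff.1 hv'
    have hw : w ∈ C := ⟨.single hvw, hwv⟩
    refine hM k v (transGen_mono (S := C) ?_ (.head' ⟨hvC, hw, hvw.2.2⟩ (hreach w v hwv hw hvC)))
    exact fun x hx => ⟨Or.inr (hCk hx), (hCM x hx).1⟩
  have hgates := fun k =>
    hX.gate_mem_of_closedWalk hL hy hH hn hg hC (fun h => (hCM y h).2 rfl) hvC hCk k
  have e₀ : g (h k₀) = j := (hCM _ (hgates k₀)).1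
  have e₁ : g (h k₁) = j := (hCM _ (hgates k₁)).1
  rw [hgh] at e₀ e₁
  rw [if_pos rfl] at e₀
  rw [if_neg hk] at e₁
  rw [← e₀] at e₁
  exact absurd e₁ (by decide)

end IsFlower

/-- A flower has at most as many petals as there are vertices, so one with the maximum number of
petals exists. -/
theorem IsFlower.exists_maximal [Finite V] {D : Digraph V} (hL : D.Loopless) {y : V} {m : ℕ}
    {X : Fin m → List V} (hX : D.IsFlower y X) : ∃ n, m ≤ n ∧ (∃ X : Fin n → List V,
      D.IsFlower y X) ∧ ¬ ∃ X' : Fin (n + 1) → List V, D.IsFlower y X' := by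
  have hbound : ∀ n, (∃ X : Fin n → List V, D.IsFlower y X) → n ≤ Nat.card V := by
    rintro n ⟨X, hX⟩
    choose f hf using fun k => List.exists_mem_of_ne_nil _ ((hX.isDicycle k).ne_nil hL)
    have hinj : Function.Injective f := by
      intro i j hij
      by_contra hne
      exact hX.disjoint i j hne (hf i) (hij ▸ hf j)
    simpa using Nat.card_le_card_of_injective f hinj
  by_contra! hno
  have key : ∀ d, ∃ X : Fin (m + d) → List V, D.IsFlower y X := by
    intro d
    induction d with
    | zero => exact ⟨X, hX⟩
    | succ d ih => exact hno (m + d) (by omega) ih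
  have := hbound _ (key (Nat.card V + 1))
  omega

theorem IsFourCritical.containsSubdivision [Finite V] {D : Digraph V} (hL : D.Loopless)
    (hD : D.IsFourCritical) :
    D.ContainsSubdivision digraphH1 ∧ D.ContainsSubdivision digraphH2 := by
  classical
  have hne : Nontrivial V := by
    by_contra hV
    rw [not_nontrivial_iff_subsingleton] at hV
    refine hD.1 ⟨fun _ => 0, fun i v hv => ?_⟩
    obtain ⟨w, hw, -⟩ := TransGen.head'_iff.1 hv
    exact hL v (Subsingleton.elim w v ▸ hw.2.2)
  obtain ⟨y, hy⟩ := exists_strongOn_compl hL hD.strongOn (hD.exists_adj_ne hL)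
  obtain ⟨X, hX⟩ := hD.exists_isFlower hL y
  obtain ⟨n, hn, ⟨X', hX'⟩, hmax⟩ := hX.exists_maximal hL
  exact ⟨hX.containsSubdivision_digraphH1 hL hy,
    hX'.containsSubdivision_digraphH2 hL hD hy hn hmax⟩

/-! ### Reduction to critical digraphs, and the lower bound -/

theorem ContainsSubdivision.of_embedding {V' W : Type*} {D : Digraph V}
    {D' : Digraph V'} {F : Digraph W} {f : V' → V} (hf : Function.Injective f)
    (hadj : ∀ a b, D'.Adj a b → D.Adj (f a) (f b)) (h : D'.ContainsSubdivision F) :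
    D.ContainsSubdivision F := by
  obtain ⟨φ, P, hφ, h₁, h₂, h₃⟩ := h
  refine ⟨f ∘ φ, fun a b => (P a b).map f, hf.comp hφ, fun a b hab => ?_, fun a b hab z hz => ?_,
    fun a b a' b' hab hab' hne => ?_⟩
  · have e : (f ∘ φ) a :: ((P a b).map f ++ [(f ∘ φ) b]) = (φ a :: (P a b ++ [φ b])).map f := by
      simp
    rw [e]
    exact ⟨List.isChain_map_of_isChain f hadj (h₁ a b hab).1, (h₁ a b hab).2.map hf⟩
  · obtain ⟨x, hx, rfl⟩ := List.mem_map.1 hz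
    rintro ⟨w, hw⟩
    exact h₂ a b hab x hx ⟨w, hf hw⟩
  · intro z hz hz'
    obtain ⟨x, hx, rfl⟩ := List.mem_map.1 hz
    obtain ⟨x', hx', e⟩ := List.mem_map.1 hz'
    obtain rfl := hf e
    exact h₃ a b a' b' hab hab' hne hx hx'

/-- The subdigraph induced by `S`, on the vertex type `S`. -/
def inducedOn (D : Digraph V) (S : Set V) : Digraph S where
  Adj a b := D.Adj a b

/-- A digraph without acyclic 3-colouring has a critical induced subdigraph. -/
theorem exists_isFourCritical [Finite V] {D : Digraph V} (h : ¬ D.ThreeColorableOn Set.univ) :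
    ∃ S : Set V, (D.inducedOn S).IsFourCritical := by
  classical
  obtain ⟨S, -, hS, hmin⟩ := Set.Finite.exists_le_minimal
    (s := {S : Set V | ¬ D.ThreeColorableOn S}) (Set.toFinite _) h
  refine ⟨S, ?_, fun T hT => ?_⟩
  · rintro ⟨c, hc⟩
    refine hS ⟨fun x => if h : x ∈ S then c ⟨x, h⟩ else 0, fun i v hv => ?_⟩
    have key : ∀ w, TransGen (D.RelOn (S ∩ (fun x => if h : x ∈ S then c ⟨x, h⟩ else 0) ⁻¹' {i}))
        v w → ∃ (hv : v ∈ S) (hw : w ∈ S),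
          TransGen ((D.inducedOn S).RelOn (Set.univ ∩ c ⁻¹' {i})) ⟨v, hv⟩ ⟨w, hw⟩ := by
      have harc : ∀ a b, D.RelOn (S ∩ (fun x => if h : x ∈ S then c ⟨x, h⟩ else 0) ⁻¹' {i}) a b →
          ∃ (ha : a ∈ S) (hb : b ∈ S),
            (D.inducedOn S).RelOn (Set.univ ∩ c ⁻¹' {i}) ⟨a, ha⟩ ⟨b, hb⟩ := by
        rintro a b ⟨⟨ha, hai⟩, ⟨hb, hbi⟩, hab⟩
        refine ⟨ha, hb, ⟨trivial, ?_⟩, ⟨trivial, ?_⟩, hab⟩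
        · simpa [ha] using hai
        · simpa [hb] using hbi
      intro w hw
      induction hw with
      | single h =>
        obtain ⟨ha, hb, h⟩ := harc _ _ h
        exact ⟨ha, hb, .single h⟩
      | tail _ h ih =>
        obtain ⟨ha, hb, h⟩ := harc _ _ h
        obtain ⟨hv, _, ih⟩ := ih
        exact ⟨hv, hb, ih.tail h⟩
    obtain ⟨hv, _, h⟩ := key v hv
    exact hc i _ h
  · have hT' : D.ThreeColorableOn (Subtype.val '' T) := by
      by_contra hno
      refine hT (Set.eq_univ_of_forall fun x => ?_)
      obtain ⟨x', hx', e⟩ := hmin hno (by rintro _ ⟨x, -, rfl⟩; exact x.2) x.2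
      exact Subtype.ext e ▸ hx'
    obtain ⟨c, hc⟩ := hT'
    refine ⟨fun x => c x, fun i v hv => hc i v (TransGen.lift Subtype.val ?_ _ _ hv)⟩
    rintro a b ⟨⟨ha, hai⟩, ⟨hb, hbi⟩, hab⟩
    exact ⟨⟨⟨a, ha, rfl⟩, hai⟩, ⟨⟨b, hb, rfl⟩, hbi⟩, hab⟩

theorem NoClosedWalk.acyclicOn {D : Digraph V} {S : Set V} (h : D.NoClosedWalk S) :
    D.AcyclicOn S := by
  intro x l hl hS
  have hxl : ∀ z, z ∈ l ∨ z = x → z ∈ S := by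
    rintro z (hz | rfl)
    · exact hS z (List.mem_cons_of_mem _ hz)
    · exact hS z (List.mem_cons_self ..)
  cases l with
  | nil => exact h x (.single ⟨hxl x (Or.inr rfl), hxl x (Or.inr rfl), hl.2⟩)
  | cons a l =>
    have ha : a ∈ S := hxl a (Or.inl (List.mem_cons_self ..))
    exact h x (.head' ⟨hxl x (Or.inr rfl), ha, (List.isChain_cons_cons.1 hl.1.1).1⟩
      (reach_mono hxl (hl.reach_center (List.mem_cons_self ..))))

theorem containsSubdivision_of_four_le_dichromaticNumber [Finite V] {D : Digraph V}
    (hL : D.Loopless) (h : 4 ≤ D.dichromaticNumber) :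
    D.ContainsSubdivision digraphH1 ∧ D.ContainsSubdivision digraphH2 := by
  have h₃ : ¬ D.ThreeColorableOn Set.univ := by
    rintro ⟨c, hc⟩
    have : D.dichromaticNumber ≤ 3 :=
      Nat.sInf_le ⟨c, fun i => ((hc i).mono (S := c ⁻¹' {i}) (by simp)).acyclicOn⟩
    omega
  obtain ⟨S, hS⟩ := exists_isFourCritical h₃
  obtain ⟨h₁, h₂⟩ := IsFourCritical.containsSubdivision (D := D.inducedOn S) (fun x => hL x) hS
  exact ⟨h₁.of_embedding Subtype.val_injective (fun _ _ h => h),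
    h₂.of_embedding Subtype.val_injective (fun _ _ h => h)⟩

/-- The complete biorientation of a triangle. -/
def bioriented3 : Digraph (ULift.{u} (Fin 3)) where
  Adj a b := a ≠ b

theorem three_le_dichromaticNumber_bioriented3 : 3 ≤ bioriented3.{u}.dichromaticNumber := by
  refine le_csInf ⟨3, ULift.down, fun i x l hl hS => ?_⟩ ?_
  · have h₁ : x.down = i := hS x (List.mem_cons_self ..)
    have h₂ : ((x :: l).getLast (List.cons_ne_nil x l)).down = i := hS _ (List.getLast_mem _)
    exact hl.2 (ULift.ext _ _ (h₂.trans h₁.symm))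
  · rintro k ⟨c, hc⟩
    have hinj : Function.Injective c := by
      intro a b hab
      by_contra hne
      refine hc (c a) a [b] ⟨⟨by simpa [bioriented3] using hne, by simpa using hne⟩, ?_⟩ ?_
      · exact fun e => hne e.symm
      · intro y hy
        rcases List.mem_cons.1 hy with rfl | hy
        · rfl
        · rw [List.mem_singleton.1 hy]
          exact hab.symm
    simpa using Fintype.card_le_of_injective c hinj

end Digraph

theorem theorem4p1 (K : Digraph (Fin 4)) (hK : K = digraphH1 ∨ K = digraphH2) :
    Digraph.HasMaderNumber.{u} K 4 := by
  refine ⟨fun V _ D hL h => ?_, fun k hk => ?_⟩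
  · have := Digraph.containsSubdivision_of_four_le_dichromaticNumber hL h
    rcases hK with rfl | rfl
    exacts [this.1, this.2]
  · by_contra hlt
    obtain ⟨φ, -, hφ, -⟩ := hk (ULift.{u} (Fin 3)) Digraph.bioriented3 (fun x h => h rfl)
      (by have := Digraph.three_le_dichromaticNumber_bioriented3.{u}; omega)
    have := Fintype.card_le_of_injective φ hφ
    simp at this
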